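/- Let $u\in C^1(\mathbb{R})$ be a non-negative real function that vanishes outside $[-d,d]$, whose only critical point in the region $\{x: u(x)>0\}$ is $x=0$, and which satisfies $0<u(0)<\pi$. For $z\in\mathbb{C}\setminus\{0\}$ consider the scattering problem $$\Phi_x=\tfrac14\left(z-\tfrac1z\right)\cos\left(\tfrac u2\right)\begin{pmatrix}-i&0\\0&i\end{pmatrix}\Phi+\tfrac14\left(z+\tfrac1z\right)\sin\left(\tfrac u2\right)\begin{pmatrix}0&i\\i&0\end{pmatrix}\Phi,\qquad \Phi=(\phi_1,\phi_2)^T,\quad x\in\mathbb{R},$$ and call $z$ an eigenvalue if this system has a nonzero solution $\Phi\in L^2(\mathbb{R};\mathbb{C}^2)$ (an eigenfunction). For $\operatorname{Im}z>0$ let $\Psi(\cdot,z)$ and $\Phi(\cdot,z)$ be the Jost solutions, i.e. the solutions with $$\Psi(x,z)\sim e^{\frac i4(z-\frac1z)\int_x^0\cos(u/2)\,dy}\begin{pmatrix}1\\0\end{pmatrix}\ (x\to-\infty),\qquad \Phi(x,z)\sim e^{\frac i4(z-\frac1z)\int_0^x\cos(u/2)\,dy}\begin{pmatrix}0\\1\end{pmatrix}\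 (x\to+\infty),$$ and let $W(z)=\psi_1\phi_2-\psi_2\phi_1$ be their Wronskian, which does not depend on $x$. An eigenvalue $z$ with $\operatorname{Im}z>0$ is called simple if its eigenfunctions are all proportional to each other and $z$ is a simple zero of $W$, i.e. $W(z)=0$ and $W'(z)\neq0$. Then there is a largest non-negative integer $N$ such that $\int_{-d}^{d}\sin\left(\frac{u}{2}\right)dx>(2N-1)\pi$, and the open first quadrant $\{z:\operatorname{Re}z>0,\ \operatorname{Im}z>0\}$ contains exactly $N$ eigenvalues. All of them lie on the unit circle $|z|=1$ and are simple. -/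

import Mathlib

open Filter Topology MeasureTheory
open scoped Matrix

noncomputable section

namespace SineGordon

/-- The matrix `τ₁ = diag(-i, i)`. -/
def tau1 : Matrix (Fin 2) (Fin 2) ℂ := !![-Complex.I, 0; 0, Complex.I]

/-- The matrix `τ₂`, with both off-diagonal entries equal to `i`. -/
def tau2 : Matrix (Fin 2) (Fin 2) ℂ := !![0, Complex.I; Complex.I, 0]

/-- The coefficient matrix
`(1/4)(z - 1/z) cos(u/2) τ₁ + (1/4)(z + 1/z) sin(u/2) τ₂` of the stationary scattering problem. -/
def pencil (u : ℝ → ℝ) (z : ℂ) (x : ℝ) : Matrix (Fin 2) (Fin 2) ℂ :=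
  ((1 / 4 : ℂ) * (z - 1 / z) * (Real.cos (u x / 2) : ℂ)) • tau1 +
    ((1 / 4 : ℂ) * (z + 1 / z) * (Real.sin (u x / 2) : ℂ)) • tau2

/-- `Φ` solves `Φ_x = (1/4)(z - 1/z) cos(u/2) τ₁ Φ + (1/4)(z + 1/z) sin(u/2) τ₂ Φ` on `ℝ`. -/
def IsSolution (u : ℝ → ℝ) (z : ℂ) (Φ : ℝ → Fin 2 → ℂ) : Prop :=
  ∀ x : ℝ, HasDerivAt Φ (pencil u z x *ᵥ Φ x) x

/-- `Φ` is a nonzero solution whose components are square integrable on `ℝ`. -/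
def IsEigenfunction (u : ℝ → ℝ) (z : ℂ) (Φ : ℝ → Fin 2 → ℂ) : Prop :=
  IsSolution u z Φ ∧ Φ ≠ 0 ∧ ∀ i : Fin 2, MemLp (fun x => Φ x i) 2 volume

/-- `z` is an eigenvalue of the scattering problem on `L²(ℝ)`. -/
def IsEigenvalue (u : ℝ → ℝ) (z : ℂ) : Prop :=
  z ≠ 0 ∧ ∃ Φ : ℝ → Fin 2 → ℂ, IsEigenfunction u z Φ

/-- The Jost solution `Ψ ∼ exp(-(1/4)(z - 1/z) ∫_x^0 cos(u/2) dy τ₁) (1, 0)ᵀ` as `x → -∞`.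
Since `τ₁ (1, 0)ᵀ = -i (1, 0)ᵀ`, the matrix exponential acts here as the scalar
`exp((i/4)(z - 1/z) ∫_x^0 cos(u/2) dy)`. -/
def IsLeftJost (u : ℝ → ℝ) (z : ℂ) (Ψ : ℝ → Fin 2 → ℂ) : Prop :=
  IsSolution u z Ψ ∧
    Tendsto (fun x : ℝ =>
      Complex.exp (-(Complex.I / 4 * (z - 1 / z) *
        ((∫ y in x..0, Real.cos (u y / 2) : ℝ) : ℂ))) • Ψ x)
      atBot (𝓝 ![1, 0])

/-- The Jost solution `Φ ∼ exp((1/4)(z - 1/z) ∫_0^x cos(u/2) dy τ₁) (0, 1)ᵀ` as `x → +∞`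
(the case of topological charge zero). Since `τ₁ (0, 1)ᵀ = i (0, 1)ᵀ`, the matrix exponential acts
here as the scalar `exp((i/4)(z - 1/z) ∫_0^x cos(u/2) dy)`. -/
def IsRightJost (u : ℝ → ℝ) (z : ℂ) (Φ : ℝ → Fin 2 → ℂ) : Prop :=
  IsSolution u z Φ ∧
    Tendsto (fun x : ℝ =>
      Complex.exp (-(Complex.I / 4 * (z - 1 / z) *
        ((∫ y in (0 : ℝ)..x, Real.cos (u y / 2) : ℝ) : ℂ))) • Φ x)
      atTop (𝓝 ![0, 1])

/-- On the open upper half plane, `W` is the Wronskian `ψ₁ φ₂ - ψ₂ φ₁` (which does not depend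
on `x`) of the Jost solutions `Ψ(·, z)` and `Φ(·, z)`. -/
def IsJostWronskian (u : ℝ → ℝ) (W : ℂ → ℂ) : Prop :=
  ∀ z : ℂ, 0 < z.im → ∃ Ψ Φ : ℝ → Fin 2 → ℂ, IsLeftJost u z Ψ ∧ IsRightJost u z Φ ∧
    ∀ x : ℝ, W z = Ψ x 0 * Φ x 1 - Ψ x 1 * Φ x 0

/-- `z` (in the open upper half plane) is a simple eigenvalue: it is an eigenvalue, any two of its
eigenfunctions are proportional, and it is a simple zero of the Wronskian of the Jost solutions. -/
def IsSimpleEigenvalue (u : ℝ → ℝ) (z : ℂ) : Prop :=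
  IsEigenvalue u z ∧
    (∀ Φ Ψ : ℝ → Fin 2 → ℂ, IsEigenfunction u z Φ → IsEigenfunction u z Ψ →
      ∃ c : ℂ, Ψ = c • Φ) ∧
    ∃ W : ℂ → ℂ, IsJostWronskian u W ∧ W z = 0 ∧ ∃ W' : ℂ, HasDerivAt W W' z ∧ W' ≠ 0

end SineGordon

end

/-! Write a = (z - 1/z)/4, b = (z + 1/z)/4 and let f, g be the two components. Off the support of u
they are pure exponentials, so for Im z > 0 an eigenfunction is exactly a nonzero solution with
g(-d) = 0 and f(d) = 0 (`isEigenfunction_iff`).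

Everything rests on the sign of one quadratic form, the integral of `formDensity`. With k = (|z|² -
1)/(|z|² + 1), the derivative of Re(f·conj g) is k times that density, so k times the form vanishes
on an eigenfunction (`mul_form_eq_zero`). The form itself is negative (`form_neg`), hence k = 0 and
|z| = 1. Negativity uses the single hump: on the left half line u is nondecreasing, so cot(u/2) is
nonincreasing, and integrating the derivative of cot(u/2)|g|² bounds the form there by
-cot(u(0)/2)|g(0)|². Reflection treats the right half, and u(0) < π makes the cotangent positive.

On z = exp(iθ), f is real and g imaginary, and f + g has a continuous argument; let η(θ) be its
value at d (`exists_angle`). Eigenvalues are the zeros of cos η, with η(0) = S/2, S the integral of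
sin(u/2), and η(π/2) = 0. The derivative in the spectral parameter of the Wronskian is the same form
up to a nonzero factor (`hasDerivAt_wronskian`, `integral_eq_form`). Its sign makes η decrease
strictly through each zero of cos η, so precisely the levels π/2 + mπ in (0, S/2) are attained, each
once (`encard_zeros`). The same nonvanishing gives W' ≠ 0. -/

namespace SineGordon

/-! ### Linear equations with a parameter: Dyson series -/

section LinearODE

variable {P E : Type*} [TopologicalSpace P] [NormedAddCommGroup E] [NormedSpace ℝ E]

/-- The `n`-th term of the Dyson series of `Φ' = A Φ`, `Φ t₀ = v`. -/
noncomputable def dysonTerm (A : P → ℝ → E →L[ℝ] E) (t₀ : ℝ) (v : E) : ℕ → P → ℝ → E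
  | 0 => fun _ _ => v
  | n + 1 => fun p x => ∫ t in t₀..x, A p t (dysonTerm A t₀ v n p t)

theorem continuous_coeff_apply {A : P → ℝ → E →L[ℝ] E} (hA : Continuous (Function.uncurry A))
    {f : P → ℝ → E} (hf : Continuous (Function.uncurry f)) :
    Continuous (Function.uncurry fun p t => A p t (f p t)) :=
  hA.clm_apply hf

theorem continuous_dysonTerm {A : P → ℝ → E →L[ℝ] E} (hA : Continuous (Function.uncurry A))
    (t₀ : ℝ) (v : E) (n : ℕ) : Continuous (Function.uncurry (dysonTerm A t₀ v n)) := by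
  induction n with
  | zero => exact continuous_const
  | succ n ih =>
    exact intervalIntegral.continuous_parametric_primitive_of_continuous
      (continuous_coeff_apply hA ih)

/-- Each integration of |t - t₀|^n contributes 1/(n + 1), so the Dyson series is dominated by an
exponential series. -/
theorem norm_dysonTerm_le {P : Type*} {A : P → ℝ → E →L[ℝ] E} {C : P → ℝ}
    (hC : ∀ p t, ‖A p t‖ ≤ C p) (t₀ : ℝ) (v : E) (n : ℕ) (p : P) (x : ℝ) :
    ‖dysonTerm A t₀ v n p x‖ ≤ ‖v‖ * (C p ^ n * |x - t₀| ^ n / n.factorial) := by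
  have hC0 : 0 ≤ C p := (norm_nonneg _).trans (hC p 0)
  induction n generalizing x with
  | zero => simp [dysonTerm]
  | succ n ih =>
    have h1 : ‖∫ t in t₀..x, A p t (dysonTerm A t₀ v n p t)‖ ≤
        |∫ t in t₀..x, (‖v‖ * C p ^ (n + 1) / n.factorial) * |t - t₀| ^ n| := by
      apply intervalIntegral.norm_integral_le_abs_of_norm_le
      · refine Eventually.of_forall fun t => ?_
        calc ‖A p t (dysonTerm A t₀ v n p t)‖
            ≤ C p * (‖v‖ * (C p ^ n * |t - t₀| ^ n / n.factorial)) :=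
              (A p t).le_of_opNorm_le_of_le (hC p t) (ih t)
          _ = _ := by ring
      · exact Continuous.intervalIntegrable (by fun_prop) _ _
    refine h1.trans (le_of_eq ?_)
    rw [intervalIntegral.integral_const_mul, abs_mul, intervalIntegral.abs_intervalIntegral_eq,
      integral_pow_abs_sub_uIoc, abs_of_nonneg (by positivity : 0 ≤ |x - t₀| ^ (n + 1) / _),
      abs_of_nonneg (by positivity), Nat.factorial_succ]
    push_cast
    field_simp

theorem hasDerivAt_dysonTerm [CompleteSpace E] {A : P → ℝ → E →L[ℝ] E}
    (hA : Continuous (Function.uncurry A)) (t₀ : ℝ) (v : E) (n : ℕ) (p : P) (y : ℝ) :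
    HasDerivAt (dysonTerm A t₀ v (n + 1) p) (A p y (dysonTerm A t₀ v n p y)) y := by
  have hc : Continuous fun t => A p t (dysonTerm A t₀ v n p t) :=
    (continuous_coeff_apply hA (continuous_dysonTerm hA t₀ v n)).comp (Continuous.prodMk_right p)
  exact intervalIntegral.integral_hasDerivAt_right (hc.intervalIntegrable _ _)
    (hc.stronglyMeasurableAtFilter _ _) hc.continuousAt

theorem dysonTerm_succ_self {P : Type*} (A : P → ℝ → E →L[ℝ] E) (t₀ : ℝ) (v : E) (n : ℕ) (p : P) :
    dysonTerm A t₀ v (n + 1) p t₀ = 0 := by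
  simp [dysonTerm]

/-- A linear differential equation with bounded coefficients that depend continuously on time and
on a parameter has a global solution, jointly continuous in time and parameter. -/
theorem exists_continuous_solution [CompleteSpace E] (A : P → ℝ → E →L[ℝ] E)
    (hA : Continuous (Function.uncurry A)) (C : P → ℝ) (hCc : Continuous C)
    (hC : ∀ p t, ‖A p t‖ ≤ C p) (t₀ : ℝ) (v : E) :
    ∃ Φ : P → ℝ → E, Continuous (Function.uncurry Φ) ∧ (∀ p, Φ p t₀ = v) ∧
      ∀ p t, HasDerivAt (Φ p) (A p t (Φ p t)) t := by
  have hC0 : ∀ p, 0 ≤ C p := fun p => (norm_nonneg _).trans (hC p 0)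
  have hsum : ∀ K R : ℝ, Summable fun n : ℕ => ‖v‖ * (K ^ n * R ^ n / n.factorial) := by
    intro K R
    simp_rw [← mul_pow]
    exact (Real.summable_pow_div_factorial _).mul_left _
  have hterm : ∀ (p : P) (x K R : ℝ) (n : ℕ), C p ≤ K → |x - t₀| ≤ R →
      ‖dysonTerm A t₀ v n p x‖ ≤ ‖v‖ * (K ^ n * R ^ n / n.factorial) := by
    intro p x K R n hK hR
    refine (norm_dysonTerm_le hC t₀ v n p x).trans ?_
    have := hC0 p
    gcongr
    exact pow_nonneg (this.trans hK) n
  have hsm : ∀ p x, Summable fun n => dysonTerm A t₀ v n p x := fun p x =>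
    Summable.of_norm_bounded (hsum (C p) |x - t₀|) fun n => hterm p x _ _ n le_rfl le_rfl
  refine ⟨fun p x => ∑' n, dysonTerm A t₀ v n p x, ?_, ?_, ?_⟩
  · rw [continuous_iff_continuousAt]
    rintro ⟨p₀, x₀⟩
    -- On this neighbourhood one numerical series dominates all terms, which makes the sum jointly
    -- continuous.
    have hopen : IsOpen {q : P × ℝ | C q.1 < C p₀ + 1 ∧ |q.2 - t₀| < |x₀ - t₀| + 1} :=
      by
      apply IsOpen.and <;> exact isOpen_lt (by fun_prop) (by fun_prop)
    refine ContinuousOn.continuousAt ?_ (hopen.mem_nhds (by constructor <;> simp))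
    exact continuousOn_tsum (f := fun n (q : P × ℝ) => dysonTerm A t₀ v n q.1 q.2)
      (fun n => (continuous_dysonTerm hA t₀ v n).continuousOn)
      (hsum (C p₀ + 1) (|x₀ - t₀| + 1)) (fun n q hq => hterm _ _ _ _ n hq.1.le hq.2.le)
  · intro p
    change ∑' n, dysonTerm A t₀ v n p t₀ = v
    rw [tsum_eq_single 0]
    · rfl
    · intro n hn
      obtain ⟨m, rfl⟩ := Nat.exists_eq_succ_of_ne_zero hn
      exact dysonTerm_succ_self A t₀ v m p
  · intro p x
    set R := |x - t₀| + 1 with hR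
    have key : HasDerivAt (fun y => ∑' n, dysonTerm A t₀ v (n + 1) p y)
        (∑' n, A p x (dysonTerm A t₀ v n p x)) x := by
      refine hasDerivAt_tsum_of_isPreconnected
        (g := fun n y => dysonTerm A t₀ v (n + 1) p y)
        (g' := fun n y => A p y (dysonTerm A t₀ v n p y)) (t := Metric.ball t₀ R) (y₀ := t₀)
        (u := fun n => C p * (‖v‖ * (C p ^ n * R ^ n / n.factorial)))
        ((hsum _ _).mul_left _) Metric.isOpen_ball (convex_ball _ _).isPreconnected
        (fun n y _ => hasDerivAt_dysonTerm hA t₀ v n p y) ?_ (Metric.mem_ball_self (by positivity)) ?_ ?_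
      · intro n y hy
        rw [Metric.mem_ball, Real.dist_eq] at hy
        exact (A p y).le_of_opNorm_le_of_le (hC p y) (hterm p y _ _ n le_rfl hy.le)
      · simp only [dysonTerm_succ_self]
        exact summable_zero
      · rw [Metric.mem_ball, Real.dist_eq, hR]; linarith
    have heq : (fun y => ∑' n, dysonTerm A t₀ v n p y) =
        fun y => v + ∑' n, dysonTerm A t₀ v (n + 1) p y := by
      funext y
      rw [(hsm p y).tsum_eq_zero_add]
      rfl
    change HasDerivAt (fun y => ∑' n, dysonTerm A t₀ v n p y)
      (A p x (∑' n, dysonTerm A t₀ v n p x)) x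
    rw [ContinuousLinearMap.map_tsum _ (hsm p x), heq]
    exact key.const_add v

end LinearODE

/-! ### The scalar system, its Wronskian and its symmetries -/

/-- The scalar form of the scattering problem: `f' = -i a cos(u/2) f + i b sin(u/2) g` and
`g' = i b sin(u/2) f + i a cos(u/2) g`. -/
def IsSolPair (u : ℝ → ℝ) (a b : ℂ) (f g : ℝ → ℂ) : Prop :=
  (∀ x, HasDerivAt f (-(Complex.I * a * (Real.cos (u x / 2) : ℂ)) * f x +
    Complex.I * b * (Real.sin (u x / 2) : ℂ) * g x) x) ∧
  ∀ x, HasDerivAt g (Complex.I * b * (Real.sin (u x / 2) : ℂ) * f x +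
    Complex.I * a * (Real.cos (u x / 2) : ℂ) * g x) x

theorem isSolution_iff (u : ℝ → ℝ) (z : ℂ) (Φ : ℝ → Fin 2 → ℂ) :
    IsSolution u z Φ ↔ IsSolPair u (1 / 4 * (z - 1 / z)) (1 / 4 * (z + 1 / z))
      (fun x => Φ x 0) (fun x => Φ x 1) := by
  simp only [IsSolution, IsSolPair, ← forall_and]
  refine forall_congr' fun x => ?_
  rw [hasDerivAt_pi, Fin.forall_fin_two]
  have h0 : (pencil u z x *ᵥ Φ x) 0 = -(Complex.I * (1 / 4 * (z - 1 / z)) *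
      (Real.cos (u x / 2) : ℂ)) * Φ x 0 +
      Complex.I * (1 / 4 * (z + 1 / z)) * (Real.sin (u x / 2) : ℂ) * Φ x 1 := by
    simp [pencil, tau1, tau2, Matrix.mulVec, dotProduct, Fin.sum_univ_two]
    ring
  have h1 : (pencil u z x *ᵥ Φ x) 1 = Complex.I * (1 / 4 * (z + 1 / z)) *
      (Real.sin (u x / 2) : ℂ) * Φ x 0 +
      Complex.I * (1 / 4 * (z - 1 / z)) * (Real.cos (u x / 2) : ℂ) * Φ x 1 := by
    simp [pencil, tau1, tau2, Matrix.mulVec, dotProduct, Fin.sum_univ_two]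
    ring
  rw [h0, h1]

/-- The diagonal part of the coefficient matrix. -/
noncomputable def diagPart : ℂ × ℂ →L[ℝ] ℂ × ℂ :=
  (-(Complex.I • ContinuousLinearMap.fst ℝ ℂ ℂ)).prod (Complex.I • ContinuousLinearMap.snd ℝ ℂ ℂ)

/-- The off-diagonal part of the coefficient matrix. -/
noncomputable def offDiagPart : ℂ × ℂ →L[ℝ] ℂ × ℂ :=
  (Complex.I • ContinuousLinearMap.snd ℝ ℂ ℂ).prod (Complex.I • ContinuousLinearMap.fst ℝ ℂ ℂ)

theorem exists_solPair (u : ℝ → ℝ) (hu : Continuous u) (t₀ : ℝ) (v : ℂ × ℂ) :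
    ∃ f g : ℂ × ℂ → ℝ → ℂ, Continuous (Function.uncurry f) ∧ Continuous (Function.uncurry g) ∧
      (∀ p, f p t₀ = v.1 ∧ g p t₀ = v.2) ∧ ∀ p, IsSolPair u p.1 p.2 (f p) (g p) := by
  obtain ⟨Φ, hc, h0, hd⟩ := exists_continuous_solution (P := ℂ × ℂ) (E := ℂ × ℂ)
    (fun p t => (p.1 * (Real.cos (u t / 2) : ℂ)) • diagPart +
      (p.2 * (Real.sin (u t / 2) : ℂ)) • offDiagPart)
    (by
      have : Continuous fun q : (ℂ × ℂ) × ℝ => u q.2 := by fun_prop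
      have h1 : Continuous fun q : (ℂ × ℂ) × ℝ => ((Real.cos (u q.2 / 2) : ℝ) : ℂ) := by fun_prop
      have h2 : Continuous fun q : (ℂ × ℂ) × ℝ => ((Real.sin (u q.2 / 2) : ℝ) : ℂ) := by fun_prop
      exact (((continuous_fst.comp continuous_fst).mul h1).smul continuous_const).add
        (((continuous_snd.comp continuous_fst).mul h2).smul continuous_const))
    (fun p => ‖p.1‖ * ‖diagPart‖ + ‖p.2‖ * ‖offDiagPart‖) (by fun_prop)
    (by
      intro p t
      refine (norm_add_le _ _).trans ?_
      rw [norm_smul, norm_smul, norm_mul, norm_mul, Complex.norm_real, Complex.norm_real]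
      have h1 := Real.abs_cos_le_one (u t / 2)
      have h2 := Real.abs_sin_le_one (u t / 2)
      gcongr
      · exact mul_le_of_le_one_right (norm_nonneg _) h1
      · exact mul_le_of_le_one_right (norm_nonneg _) h2) t₀ v
  refine ⟨fun p t => (Φ p t).1, fun p t => (Φ p t).2, continuous_fst.comp hc,
    continuous_snd.comp hc, fun p => by simp [h0 p], fun p => ⟨fun x => ?_, fun x => ?_⟩⟩
  · refine HasDerivAt.congr_deriv
      (f := fun x => (Φ p x).1) ((hasFDerivAt_fst (p := Φ p x)).comp_hasDerivAt x (hd p x)) ?_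
    simp [diagPart, offDiagPart]
    ring
  · refine HasDerivAt.congr_deriv
      (f := fun x => (Φ p x).2) ((hasFDerivAt_snd (p := Φ p x)).comp_hasDerivAt x (hd p x)) ?_
    simp [diagPart, offDiagPart]
    ring

theorem eq_of_hasDerivAt_zero_of_convex {s : Set ℝ} (hs : Convex ℝ s) {F : ℝ → ℂ}
    (hF : ∀ x ∈ s, HasDerivAt F 0 x) {x y : ℝ} (hx : x ∈ s) (hy : y ∈ s) : F x = F y := by
  have := hs.norm_image_sub_le_of_norm_hasDerivWithin_le (f := F) (f' := fun _ => 0) (C := 0)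
    (fun t ht => (hF t ht).hasDerivWithinAt) (by simp) hy hx
  simpa [sub_eq_zero] using this

/-- A solution of `y' = k v' y` is a multiple of `exp (k v)`. -/
theorem mul_exp_eq_of_hasDerivAt {s : Set ℝ} (hs : Convex ℝ s) {y : ℝ → ℂ} {v v' : ℝ → ℝ} {k : ℂ}
    (hv : ∀ x ∈ s, HasDerivAt v (v' x) x) (hy : ∀ x ∈ s, HasDerivAt y (k * (v' x : ℂ) * y x) x)
    {x x₀ : ℝ} (hx : x ∈ s) (hx₀ : x₀ ∈ s) :
    y x * Complex.exp (-(k * (v x : ℂ))) = y x₀ * Complex.exp (-(k * (v x₀ : ℂ))) := by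
  refine eq_of_hasDerivAt_zero_of_convex hs
    (F := fun t => y t * Complex.exp (-(k * (v t : ℂ)))) (fun t ht => ?_) hx hx₀
  refine ((hy t ht).mul (((hv t ht).ofReal_comp.const_mul k).neg.cexp)).congr_deriv ?_
  ring

theorem wronskian_hasDerivAt {u : ℝ → ℝ} {a b a' b' : ℂ} {f g p q : ℝ → ℂ}
    (h : IsSolPair u a' b' f g) (h' : IsSolPair u a b p q) (x : ℝ) :
    HasDerivAt (fun x => f x * q x - g x * p x)
      (-(a' - a) * (Complex.I * (Real.cos (u x / 2) : ℂ) * (f x * q x + g x * p x)) +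
        (b' - b) * (Complex.I * (Real.sin (u x / 2) : ℂ) * (g x * q x - f x * p x))) x := by
  refine (((h.1 x).mul (h'.2 x)).sub ((h.2 x).mul (h'.1 x))).congr_deriv ?_
  ring

theorem wronskian_const {u : ℝ → ℝ} {a b : ℂ} {f g p q : ℝ → ℂ}
    (h : IsSolPair u a b f g) (h' : IsSolPair u a b p q) (x y : ℝ) :
    f x * q x - g x * p x = f y * q y - g y * p y := by
  refine eq_of_hasDerivAt_zero_of_convex convex_univ (F := fun x => f x * q x - g x * p x)
    (fun t _ => (wronskian_hasDerivAt h h' t).congr_deriv ?_) (Set.mem_univ x) (Set.mem_univ y)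
  ring

namespace IsSolPair

variable {u : ℝ → ℝ} {a b : ℂ} {f g p q : ℝ → ℂ}

theorem continuous_fst (h : IsSolPair u a b f g) : Continuous f :=
  continuous_iff_continuousAt.2 fun x => (h.1 x).continuousAt

theorem continuous_snd (h : IsSolPair u a b f g) : Continuous g :=
  continuous_iff_continuousAt.2 fun x => (h.2 x).continuousAt

theorem sub (h : IsSolPair u a b f g) (h' : IsSolPair u a b p q) :
    IsSolPair u a b (fun x => f x - p x) (fun x => g x - q x) :=
  ⟨fun x => ((h.1 x).sub (h'.1 x)).congr_deriv (by ring),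
    fun x => ((h.2 x).sub (h'.2 x)).congr_deriv (by ring)⟩

theorem const_mul (h : IsSolPair u a b f g) (c : ℂ) :
    IsSolPair u a b (fun x => c * f x) (fun x => c * g x) :=
  ⟨fun x => ((h.1 x).const_mul c).congr_deriv (by ring),
    fun x => ((h.2 x).const_mul c).congr_deriv (by ring)⟩

/-- Reflecting the potential. -/
theorem reflect (h : IsSolPair u a b f g) :
    IsSolPair (fun x => u (-x)) a b (fun x => g (-x)) (fun x => -f (-x)) := by
  refine ⟨fun x => ?_, fun x => ?_⟩
  · refine ((h.2 (-x)).scomp x (hasDerivAt_neg x)).congr_deriv ?_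
    simp only [neg_smul, one_smul]
    ring
  · refine ((h.1 (-x)).scomp x (hasDerivAt_neg x)).neg.congr_deriv ?_
    simp only [neg_smul, one_smul]
    ring

/-- Cramer's rule: the Wronskians with two solutions whose mutual Wronskian is 1 are constant, hence
zero. -/
theorem eq_zero_of_apply_eq_zero (hu : Continuous u) (h : IsSolPair u a b f g) {t : ℝ}
    (hf : f t = 0) (hg : g t = 0) (x : ℝ) : f x = 0 ∧ g x = 0 := by
  obtain ⟨p, q, -, -, h0, hs⟩ := exists_solPair u hu t (1, 0)
  obtain ⟨r, w, -, -, h0', hs'⟩ := exists_solPair u hu t (0, 1)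
  have e1 := wronskian_const h (hs (a, b)) x t
  have e2 := wronskian_const h (hs' (a, b)) x t
  have e3 := wronskian_const (hs (a, b)) (hs' (a, b)) x t
  simp only [hf, hg, h0, h0', mul_zero, sub_zero, mul_one] at e1 e2 e3
  constructor
  · linear_combination (-(f x)) * e3 - r (a, b) x * e1 + p (a, b) x * e2
  · linear_combination (-(g x)) * e3 - w (a, b) x * e1 + q (a, b) x * e2

theorem eq_of_apply_eq (hu : Continuous u) (h : IsSolPair u a b f g) (h' : IsSolPair u a b p q)
    {t : ℝ} (hf : f t = p t) (hg : g t = q t) (x : ℝ) : f x = p x ∧ g x = q x := by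
  have := (h.sub h').eq_zero_of_apply_eq_zero hu (t := t) (by simp [hf]) (by simp [hg]) x
  exact ⟨sub_eq_zero.1 this.1, sub_eq_zero.1 this.2⟩

/-- For imaginary `a` and real `b`, complex conjugation acts on solutions. -/
theorem conj {a b : ℝ} (h : IsSolPair u (Complex.I * a) b f g) :
    IsSolPair u (Complex.I * a) b (fun x => starRingEnd ℂ (f x)) (fun x => -starRingEnd ℂ (g x)) := by
  refine ⟨fun x => (h.1 x).star.congr_deriv ?_, fun x => (h.2 x).star.neg.congr_deriv ?_⟩
  all_goals
    simp only [← starRingEnd_apply, map_add, map_mul, map_neg, Complex.conj_I, Complex.conj_ofReal]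
    ring

theorem snd_mul_exp_eq (h : IsSolPair u a b f g) {s : Set ℝ} (hs : Convex ℝ s)
    (h0 : ∀ x ∈ s, u x = 0) {x y : ℝ} (hx : x ∈ s) (hy : y ∈ s) :
    g x * Complex.exp (-(Complex.I * a * (x : ℂ))) =
      g y * Complex.exp (-(Complex.I * a * (y : ℂ))) := by
  refine mul_exp_eq_of_hasDerivAt hs (v := fun x => x) (v' := fun _ => 1)
    (fun x _ => hasDerivAt_id x) (fun t ht => (h.2 t).congr_deriv ?_) hx hy
  simp [h0 t ht]

theorem fst_mul_exp_eq (h : IsSolPair u a b f g) {s : Set ℝ} (hs : Convex ℝ s)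
    (h0 : ∀ x ∈ s, u x = 0) {x y : ℝ} (hx : x ∈ s) (hy : y ∈ s) :
    f x * Complex.exp (Complex.I * a * (x : ℂ)) =
      f y * Complex.exp (Complex.I * a * (y : ℂ)) := by
  have := mul_exp_eq_of_hasDerivAt hs (y := f) (k := -(Complex.I * a)) (v := fun x => x)
    (v' := fun _ => 1)
    (fun x _ => hasDerivAt_id x) (fun t ht => (h.1 t).congr_deriv (by simp [h0 t ht])) hx hy
  simpa using this

theorem snd_eq_zero (h : IsSolPair u a b f g) {s : Set ℝ} (hs : Convex ℝ s)
    (h0 : ∀ x ∈ s, u x = 0) {x y : ℝ} (hx : x ∈ s) (hy : y ∈ s) (hg : g y = 0) : g x = 0 := by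
  have := h.snd_mul_exp_eq hs h0 hx hy
  simpa [hg, Complex.exp_ne_zero] using this

theorem fst_eq_zero (h : IsSolPair u a b f g) {s : Set ℝ} (hs : Convex ℝ s)
    (h0 : ∀ x ∈ s, u x = 0) {x y : ℝ} (hx : x ∈ s) (hy : y ∈ s) (hf : f y = 0) : f x = 0 := by
  have := h.fst_mul_exp_eq hs h0 hx hy
  simpa [hf, Complex.exp_ne_zero] using this

end IsSolPair

/-! ### Monotonicity and signs for the single-hump potential -/

/-- The hypotheses on the potential. -/
structure IsBump (u : ℝ → ℝ) (d : ℝ) : Prop where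
  contDiff : ContDiff ℝ 1 u
  nonneg : ∀ x, 0 ≤ u x
  supp : ∀ x, x ∉ Set.Icc (-d) d → u x = 0
  crit : ∀ x, 0 < u x → (deriv u x = 0 ↔ x = 0)
  pos : 0 < u 0
  lt : u 0 < Real.pi

namespace IsBump

variable {u : ℝ → ℝ} {d : ℝ}

theorem continuous (h : IsBump u d) : Continuous u := h.contDiff.continuous

theorem differentiable (h : IsBump u d) : Differentiable ℝ u := h.contDiff.differentiable (by norm_num)

theorem reflect (h : IsBump u d) : IsBump (fun x => u (-x)) d where
  contDiff := h.contDiff.comp contDiff_neg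
  nonneg x := h.nonneg _
  supp x hx := h.supp _ fun hx' => hx ⟨by linarith [hx'.2], by linarith [hx'.1]⟩
  crit x hx := by
    rw [deriv_comp_neg, neg_eq_zero, h.crit _ hx, neg_eq_zero]
  pos := by simpa using h.pos
  lt := by simpa using h.lt

theorem eq_zero_of_le (h : IsBump u d) {x : ℝ} (hx : x ≤ -d) : u x = 0 := by
  have hcl : IsClosed {y | u y = 0} := isClosed_eq h.continuous continuous_const
  have : Set.Iic (-d) ⊆ {y | u y = 0} := by
    rw [← closure_Iio]
    exact hcl.closure_subset_iff.2 fun y hy => h.supp y fun hy' => absurd hy'.1 (not_le.2 hy)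
  exact this hx

theorem eq_zero_of_ge (h : IsBump u d) {x : ℝ} (hx : d ≤ x) : u x = 0 := by
  simpa using h.reflect.eq_zero_of_le (x := -x) (by linarith)

theorem d_pos (h : IsBump u d) : 0 < d := by
  by_contra hd
  exact h.pos.ne' (h.eq_zero_of_le (by linarith))

/-- A negative slope at x < 0 would force an interior maximum of u to the left of x, that is, a
second critical point where u > 0. -/
theorem deriv_nonneg (h : IsBump u d) {x : ℝ} (hx : x < 0) : 0 ≤ deriv u x := by
  by_contra! hneg
  -- The left endpoint lies beyond the support, where u = 0, so the maximum is not attained there.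
  obtain ⟨m, hm, hmax⟩ := (isCompact_Icc (a := min (-d) x - 1) (b := x)).exists_isMaxOn
    ⟨x, by constructor <;> linarith [min_le_right (-d) x]⟩ h.continuous.continuousOn
  have hux : 0 < u x := by
    rcases (h.nonneg x).lt_or_eq with h1 | h1
    · exact h1
    · have : IsLocalMin u x := Eventually.of_forall fun y => h1 ▸ h.nonneg y
      exact absurd this.deriv_eq_zero hneg.ne
  have hum : 0 < u m := hux.trans_le (hmax ⟨by linarith [min_le_right (-d) x], le_rfl⟩)
  have hm1 : min (-d) x - 1 < m := by
    refine lt_of_le_of_ne hm.1 fun he => hum.ne' (h.eq_zero_of_le ?_)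
    rw [← he]
    linarith [min_le_left (-d) x]
  have hm2 : m < x := by
    refine lt_of_le_of_ne hm.2 fun he => ?_
    subst he
    have hev : ∀ᶠ y in 𝓝[<] m, u m < u y := by
      have := (h.differentiable m).hasDerivAt
      have h2 := (hasDerivAt_iff_tendsto_slope.1 this).mono_left
        (nhdsWithin_mono m (fun y (hy : y < m) => hy.ne))
      filter_upwards [h2.eventually (eventually_lt_nhds hneg), self_mem_nhdsWithin] with y hy hym
      rw [slope_def_field, div_lt_iff_of_neg (by simpa using hym)] at hy
      linarith
    have hev2 : ∀ᶠ y in 𝓝[<] m, min (-d) m - 1 < y := mem_nhdsWithin_of_mem_nhds (lt_mem_nhds hm1)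
    obtain ⟨y, hy1, hy2, hy3⟩ := (hev.and (hev2.and self_mem_nhdsWithin)).exists
    exact absurd (hmax ⟨hy2.le, le_of_lt hy3⟩) (not_le.2 hy1)
  have hloc : IsLocalMax u m := hmax.isLocalMax (Icc_mem_nhds hm1 hm2)
  have := (h.crit m hum).1 hloc.deriv_eq_zero
  linarith

theorem monotoneOn (h : IsBump u d) : MonotoneOn u (Set.Iic 0) := by
  refine monotoneOn_of_deriv_nonneg (convex_Iic 0) h.continuous.continuousOn
    h.differentiable.differentiableOn fun x hx => ?_
  rw [interior_Iic] at hx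
  exact h.deriv_nonneg hx

theorem le_apply_zero (h : IsBump u d) (x : ℝ) : u x ≤ u 0 := by
  rcases le_total x 0 with hx | hx
  · exact h.monotoneOn hx (Set.mem_Iic.2 le_rfl) hx
  · simpa using h.reflect.monotoneOn (a := -x) (b := 0) (by simpa using hx) (by simp) (by simpa using hx)

theorem cos_pos (h : IsBump u d) (x : ℝ) : 0 < Real.cos (u x / 2) :=
  Real.cos_pos_of_mem_Ioo ⟨by linarith [h.nonneg x, Real.pi_pos],
    by linarith [h.le_apply_zero x, h.lt]⟩

theorem sin_nonneg (h : IsBump u d) (x : ℝ) : 0 ≤ Real.sin (u x / 2) :=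
  Real.sin_nonneg_of_nonneg_of_le_pi (by linarith [h.nonneg x])
    (by linarith [h.le_apply_zero x, h.lt, Real.pi_pos])

theorem sin_pos (h : IsBump u d) {x : ℝ} (hx : 0 < u x) : 0 < Real.sin (u x / 2) :=
  Real.sin_pos_of_pos_of_lt_pi (by linarith) (by linarith [h.le_apply_zero x, h.lt, Real.pi_pos])

end IsBump

/-! ### The quadratic form and its negativity -/

theorem hasDerivAt_normSq {g : ℝ → ℂ} {g' : ℂ} {x : ℝ} (h : HasDerivAt g g' x) :
    HasDerivAt (fun x => Complex.normSq (g x)) (2 * ((g x).re * g'.re + (g x).im * g'.im)) x := by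
  have h1 : HasDerivAt (fun x => (g x).re) g'.re x :=
    Complex.reCLM.hasFDerivAt.comp_hasDerivAt x h
  have h2 : HasDerivAt (fun x => (g x).im) g'.im x :=
    Complex.imCLM.hasFDerivAt.comp_hasDerivAt x h
  simp only [Complex.normSq_apply]
  exact ((h1.mul h1).add (h2.mul h2)).congr_deriv (by ring)

theorem hasDerivAt_mul_conj_re {f g : ℝ → ℂ} {f' g' : ℂ} {x : ℝ} (h : HasDerivAt f f' x)
    (h' : HasDerivAt g g' x) :
    HasDerivAt (fun x => (f x * starRingEnd ℂ (g x)).re)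
      (f' * starRingEnd ℂ (g x) + f x * starRingEnd ℂ g').re x :=
  Complex.reCLM.hasFDerivAt.comp_hasDerivAt x (h.mul h'.star)

/-- The density of the quadratic form that controls the eigenvalues. -/
noncomputable def formDensity (u : ℝ → ℝ) (br ai : ℝ) (f g : ℝ → ℂ) (x : ℝ) : ℝ :=
  2 * br * Real.cos (u x / 2) * (f x * starRingEnd ℂ (g x)).im -
    ai * Real.sin (u x / 2) * (Complex.normSq (f x) + Complex.normSq (g x))

theorem continuous_formDensity {u : ℝ → ℝ} (hu : Continuous u) (br ai : ℝ) {f g : ℝ → ℂ}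
    (hf : Continuous f) (hg : Continuous g) : Continuous (formDensity u br ai f g) := by
  unfold formDensity
  have h1 : Continuous fun x => starRingEnd ℂ (g x) := Complex.continuous_conj.comp hg
  have h2 : Continuous fun x => (f x * starRingEnd ℂ (g x)).im :=
    Complex.continuous_im.comp (hf.mul h1)
  have h3 := Complex.continuous_normSq.comp hf
  have h4 := Complex.continuous_normSq.comp hg
  simp only [Function.comp_def] at h3 h4
  fun_prop

theorem formDensity_reflect (u : ℝ → ℝ) (br ai : ℝ) (f g : ℝ → ℂ) (x : ℝ) :
    formDensity (fun x => u (-x)) br ai (fun x => g (-x)) (fun x => -f (-x)) x =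
      formDensity u br ai f g (-x) := by
  simp only [formDensity, Complex.normSq_neg, map_neg, mul_neg, Complex.neg_im, Complex.mul_im,
    Complex.conj_re, Complex.conj_im]
  ring

theorem two_mul_abs_re_le (z w : ℂ) (t : ℝ) :
    2 * t * |(z * starRingEnd ℂ w).re| ≤ Complex.normSq z + t ^ 2 * Complex.normSq w := by
  have h := Complex.abs_re_le_norm (z * starRingEnd ℂ w)
  rw [norm_mul, RCLike.norm_conj] at h
  rw [Complex.normSq_eq_norm_sq, Complex.normSq_eq_norm_sq]
  rcases le_total 0 t with ht | ht
  · nlinarith [sq_nonneg (‖z‖ - t * ‖w‖), mul_le_mul_of_nonneg_left h ht]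
  · nlinarith [sq_nonneg ‖z‖, sq_nonneg (t * ‖w‖),
      mul_nonneg (neg_nonneg.2 ht) (abs_nonneg (z * starRingEnd ℂ w).re)]

/-- The elementary inequality behind the weighted estimate. -/
theorem weighted_ineq {s c w ai k : ℝ} {z y : ℂ} (hs : 0 ≤ s) (hc : 0 ≤ c) (hw : 0 ≤ w)
    (hsw : s * w ≤ c) (hai : 0 ≤ ai) (hk : |k| ≤ 1) :
    -2 * ai * c * w * Complex.normSq y - 2 * s * w * k * ai * (z * starRingEnd ℂ y).re ≤
      ai * s * Complex.normSq z := by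
  set X := (z * starRingEnd ℂ y).re
  have h1 : -(k * X) ≤ |X| := by
    calc -(k * X) ≤ |k * X| := neg_le_abs _
      _ = |k| * |X| := abs_mul _ _
      _ ≤ 1 * |X| := by gcongr
      _ = |X| := one_mul _
  have h2 := two_mul_abs_re_le z y w
  have h3 : 2 * s * w * |X| ≤ s * Complex.normSq z + c * w * Complex.normSq y := by
    have h4 := mul_le_mul_of_nonneg_left h2 hs
    have h5 : s * w * (w * Complex.normSq y) ≤ c * (w * Complex.normSq y) :=
      mul_le_mul_of_nonneg_right hsw (mul_nonneg hw (Complex.normSq_nonneg y))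
    nlinarith
  have h6 := mul_le_mul_of_nonneg_left h1 (mul_nonneg hs hw)
  have h7 : 0 ≤ c * w * Complex.normSq y := mul_nonneg (mul_nonneg hc hw) (Complex.normSq_nonneg y)
  have h8 : -2 * c * w * Complex.normSq y - 2 * s * w * k * X ≤ s * Complex.normSq z := by
    nlinarith
  nlinarith [mul_le_mul_of_nonneg_left h8 hai]

section LeftEstimate

variable {u : ℝ → ℝ} {d k br ai : ℝ} {f g : ℝ → ℂ}

/-- The coefficients are parametrised by three reals k, br, ai; `coeffA_eq` and `coeffB_eq` put
every z ≠ 0 in this shape. -/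
theorem normSq_snd_hasDerivAt
    (hs : IsSolPair u (k * br + ai * Complex.I) (br + k * ai * Complex.I) f g) (x : ℝ) :
    HasDerivAt (fun x => Complex.normSq (g x))
      (-2 * ai * Real.cos (u x / 2) * Complex.normSq (g x) -
        2 * Real.sin (u x / 2) * (k * ai * (f x * starRingEnd ℂ (g x)).re +
          br * (f x * starRingEnd ℂ (g x)).im)) x := by
  refine (hasDerivAt_normSq (hs.2 x)).congr_deriv ?_
  simp only [Complex.normSq_apply, Complex.add_re, Complex.add_im, Complex.mul_re, Complex.mul_im,
    Complex.I_re, Complex.I_im, Complex.ofReal_re, Complex.ofReal_im, Complex.conj_re,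
    Complex.conj_im]
  ring

theorem weight_hasDerivAt (h : IsBump u d) {ε : ℝ} (hε : 0 < ε) (x : ℝ) :
    HasDerivAt (fun x => Real.cos (u x / 2) / (Real.sin (u x / 2) + ε))
      (-((Real.sin (u x / 2) * (Real.sin (u x / 2) + ε) + Real.cos (u x / 2) ^ 2) *
        (deriv u x / 2) / (Real.sin (u x / 2) + ε) ^ 2)) x := by
  have h1 : HasDerivAt (fun x => u x / 2) (deriv u x / 2) x :=
    (h.differentiable x).hasDerivAt.div_const 2
  refine (h1.cos.div (h1.sin.add_const ε) (by linarith [h.sin_nonneg x])).congr_deriv ?_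
  ring

/-- Integrate the derivative of w|g|² with w a regularised cot(u/2); ε keeps w smooth where u = 0.
The w' term is nonpositive because u is nondecreasing on the left, and `weighted_ineq` absorbs the
terms in ai. -/
theorem weighted_boundary_le (h : IsBump u d) (hk : |k| ≤ 1) (hai : 0 ≤ ai)
    (hs : IsSolPair u (k * br + ai * Complex.I) (br + k * ai * Complex.I) f g) (hg : g (-d) = 0)
    {ε : ℝ} (hε : 0 < ε) :
    Real.cos (u 0 / 2) / (Real.sin (u 0 / 2) + ε) * Complex.normSq (g 0) ≤
      ∫ x in (-d)..0, (ai * Real.sin (u x / 2) * (Complex.normSq (f x)) -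
        2 * (Real.sin (u x / 2) * (Real.cos (u x / 2) / (Real.sin (u x / 2) + ε))) * br *
          (f x * starRingEnd ℂ (g x)).im) := by
  have hd := h.d_pos
  have hu := h.continuous
  have hf := hs.continuous_fst
  have hgc := hs.continuous_snd
  have hu' : Continuous (deriv u) := h.contDiff.continuous_deriv le_rfl
  have hne : ∀ x, Real.sin (u x / 2) + ε ≠ 0 := fun x => by linarith [h.sin_nonneg x]
  have hne2 : ∀ x, (Real.sin (u x / 2) + ε) ^ 2 ≠ 0 := fun x => pow_ne_zero 2 (hne x)
  have h1 : Continuous fun x => starRingEnd ℂ (g x) := Complex.continuous_conj.comp hgc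
  have h2 : Continuous fun x => (f x * starRingEnd ℂ (g x)).im :=
    Complex.continuous_im.comp (hf.mul h1)
  have h2' : Continuous fun x => (f x * starRingEnd ℂ (g x)).re :=
    Complex.continuous_re.comp (hf.mul h1)
  have h3 : Continuous fun x => Complex.normSq (f x) := Complex.continuous_normSq.comp hf
  have h4 : Continuous fun x => Complex.normSq (g x) := Complex.continuous_normSq.comp hgc
  have hw : Continuous fun x => Real.cos (u x / 2) / (Real.sin (u x / 2) + ε) :=
    Continuous.div (by fun_prop) (by fun_prop) hne
  have hw' : Continuous fun x => -((Real.sin (u x / 2) * (Real.sin (u x / 2) + ε) +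
      Real.cos (u x / 2) ^ 2) * (deriv u x / 2) / (Real.sin (u x / 2) + ε) ^ 2) :=
    (Continuous.div (by fun_prop) (by fun_prop) hne2).neg
  have hFTC := intervalIntegral.integral_eq_sub_of_hasDerivAt (a := -d) (b := 0)
    (fun x _ => (weight_hasDerivAt h hε x).mul (normSq_snd_hasDerivAt hs x))
    (Continuous.intervalIntegrable (by fun_prop) _ _)
  simp only [Pi.mul_apply, hg, map_zero, mul_zero, sub_zero] at hFTC
  rw [← hFTC]
  refine intervalIntegral.integral_mono_on (by linarith)
    (Continuous.intervalIntegrable (by fun_prop) _ _)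
    (Continuous.intervalIntegrable (by fun_prop) _ _) fun x hx => ?_
  have hsn := h.sin_nonneg x
  have hcp := h.cos_pos x
  have hder : 0 ≤ deriv u x := by
    rcases hx.2.lt_or_eq with h' | h'
    · exact h.deriv_nonneg h'
    · rw [h', (h.crit 0 h.pos).2 rfl]
  have hA : 0 ≤ (Real.sin (u x / 2) * (Real.sin (u x / 2) + ε) +
      Real.cos (u x / 2) ^ 2) * (deriv u x / 2) / (Real.sin (u x / 2) + ε) ^ 2 := by positivity
  have hW : 0 ≤ Real.cos (u x / 2) / (Real.sin (u x / 2) + ε) := by positivity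
  have hsw : Real.sin (u x / 2) * (Real.cos (u x / 2) / (Real.sin (u x / 2) + ε)) ≤
      Real.cos (u x / 2) := by
    rw [mul_div_assoc', div_le_iff₀ (by positivity)]
    nlinarith
  have key := weighted_ineq (z := f x) (y := g x) hsn hcp.le hW hsw hai hk
  nlinarith [mul_nonneg hA (Complex.normSq_nonneg (g x))]

/-- The form on the left half line is controlled by its boundary value at the origin. -/
theorem left_form_le (h : IsBump u d) (hk : |k| ≤ 1) (hai : 0 ≤ ai)
    (hs : IsSolPair u (k * br + ai * Complex.I) (br + k * ai * Complex.I) f g)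
    (hg : g (-d) = 0) :
    ∫ x in (-d)..0, formDensity u br ai f g x ≤
      -(Real.cos (u 0 / 2) / Real.sin (u 0 / 2) * Complex.normSq (g 0)) := by
  have hd := h.d_pos
  have hu := h.continuous
  have hf := hs.continuous_fst
  have hgc := hs.continuous_snd
  have h1 : Continuous fun x => starRingEnd ℂ (g x) := Complex.continuous_conj.comp hgc
  have h2 : Continuous fun x => (f x * starRingEnd ℂ (g x)).im :=
    Complex.continuous_im.comp (hf.mul h1)
  have h3 : Continuous fun x => Complex.normSq (f x) := Complex.continuous_normSq.comp hf
  have h4 : Continuous fun x => Complex.normSq (g x) := Complex.continuous_normSq.comp hgc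
  have hs0 := h.sin_pos h.pos
  -- By monotonicity u vanishes on the whole half line left of such an x, so g keeps its zero value
  -- from -d. This matters because there sin·w is 0 for every ε and does not tend to cos.
  have hY : ∀ x ∈ Set.Ioc (-d) 0, u x = 0 → g x = 0 := fun x hx hux =>
    hs.snd_eq_zero (convex_Iic x) (y := -d)
      (fun y hy => le_antisymm (hux ▸ h.monotoneOn (le_trans hy hx.2) hx.2 hy) (h.nonneg y))
      (Set.mem_Iic.2 le_rfl) hx.1.le hg
  have he : Tendsto (fun n : ℕ => (1 : ℝ) / (n + 1)) atTop (𝓝 0) :=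
    tendsto_one_div_add_atTop_nhds_zero_nat
  have hlhs : Tendsto (fun n : ℕ => Real.cos (u 0 / 2) / (Real.sin (u 0 / 2) + 1 / ((n : ℝ) + 1)) *
      Complex.normSq (g 0)) atTop
      (𝓝 (Real.cos (u 0 / 2) / Real.sin (u 0 / 2) * Complex.normSq (g 0))) := by
    refine Tendsto.mul_const _ (tendsto_const_nhds.div ?_ hs0.ne')
    simpa using tendsto_const_nhds.add he
  have hrhs : Tendsto (fun n : ℕ => ∫ x in (-d)..0,
      (ai * Real.sin (u x / 2) * (Complex.normSq (f x)) -
        2 * (Real.sin (u x / 2) * (Real.cos (u x / 2) / (Real.sin (u x / 2) + 1 / ((n : ℝ) + 1)))) *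
          br * (f x * starRingEnd ℂ (g x)).im)) atTop
      (𝓝 (∫ x in (-d)..0, (ai * Real.sin (u x / 2) * (Complex.normSq (f x)) -
        2 * Real.cos (u x / 2) * br * (f x * starRingEnd ℂ (g x)).im))) := by
    -- Let ε = 1/(n + 1) tend to 0; the bound sin·w ≤ cos gives a majorant independent of n.
    refine intervalIntegral.tendsto_integral_filter_of_dominated_convergence
      (fun x => ai * Real.sin (u x / 2) * (Complex.normSq (f x)) +
        2 * Real.cos (u x / 2) * |br| * |(f x * starRingEnd ℂ (g x)).im|)
      (Eventually.of_forall fun n => ?_) (Eventually.of_forall fun n => ?_)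
      (Continuous.intervalIntegrable (by fun_prop) _ _) ?_
    · have hne : ∀ x, Real.sin (u x / 2) + 1 / ((n : ℝ) + 1) ≠ 0 := fun x => by
        have := h.sin_nonneg x
        positivity
      have hw : Continuous fun x => Real.cos (u x / 2) / (Real.sin (u x / 2) + 1 / ((n : ℝ) + 1)) :=
        Continuous.div (by fun_prop) (by fun_prop) hne
      exact Continuous.aestronglyMeasurable (by fun_prop)
    · refine Eventually.of_forall fun x _ => ?_
      have hsn := h.sin_nonneg x
      have hcp := h.cos_pos x
      have hn : (0 : ℝ) < 1 / ((n : ℝ) + 1) := by positivity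
      have hsw : Real.sin (u x / 2) * (Real.cos (u x / 2) / (Real.sin (u x / 2) +
          1 / ((n : ℝ) + 1))) ≤ Real.cos (u x / 2) := by
        rw [mul_div_assoc', div_le_iff₀ (by positivity)]
        nlinarith
      have hP := Complex.normSq_nonneg (f x)
      refine (norm_sub_le _ _).trans ?_
      rw [Real.norm_of_nonneg (by positivity), norm_mul, norm_mul, Real.norm_of_nonneg
        (by positivity), Real.norm_eq_abs, Real.norm_eq_abs]
      gcongr
    · refine Eventually.of_forall fun x hx => ?_
      rw [Set.uIoc_of_le (by linarith)] at hx
      rcases (h.nonneg x).lt_or_eq with h0 | h0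
      · have hsp := h.sin_pos h0
        refine Tendsto.sub tendsto_const_nhds (Tendsto.mul_const _ (Tendsto.mul_const _
          (Tendsto.const_mul _ ?_)))
        have : Tendsto (fun n : ℕ => Real.sin (u x / 2) + 1 / ((n : ℝ) + 1)) atTop
            (𝓝 (Real.sin (u x / 2))) := by
          simpa using (tendsto_const_nhds (x := Real.sin (u x / 2))).add he
        have h5 := (tendsto_const_nhds (x := Real.sin (u x / 2))).mul
          ((tendsto_const_nhds (x := Real.cos (u x / 2))).div this hsp.ne')
        rwa [mul_div_cancel₀ _ hsp.ne'] at h5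
      · simp [hY x hx h0.symm]
  have hlim := le_of_tendsto_of_tendsto' hlhs hrhs fun n =>
    weighted_boundary_le h hk hai hs hg (by positivity)
  -- The |g|² part of the density is nonpositive and is dropped.
  have hle : ∫ x in (-d)..0, formDensity u br ai f g x ≤
      ∫ x in (-d)..0, -(ai * Real.sin (u x / 2) * (Complex.normSq (f x)) -
        2 * Real.cos (u x / 2) * br * (f x * starRingEnd ℂ (g x)).im) := by
    refine intervalIntegral.integral_mono_on (by linarith)
      ((continuous_formDensity hu br ai hf hgc).intervalIntegrable _ _)
      (Continuous.intervalIntegrable (by fun_prop) _ _) fun x _ => ?_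
    unfold formDensity
    have := mul_nonneg (mul_nonneg hai (h.sin_nonneg x)) (Complex.normSq_nonneg (g x))
    linarith
  rw [intervalIntegral.integral_neg] at hle
  linarith

/-- The form is negative definite on solutions that decay at both ends. -/
theorem form_neg (h : IsBump u d) (hk : |k| ≤ 1) (hai : 0 ≤ ai)
    (hs : IsSolPair u (k * br + ai * Complex.I) (br + k * ai * Complex.I) f g)
    (hg : g (-d) = 0) (hf : f d = 0) (hne : f (-d) ≠ 0) :
    ∫ x in (-d)..d, formDensity u br ai f g x < 0 := by
  have hcont := continuous_formDensity h.continuous br ai hs.continuous_fst hs.continuous_snd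
  have hl := left_form_le h hk hai hs hg
  -- Reflection exchanges the components, turning f(d) = 0 into the boundary condition on the left.
  have hr := left_form_le h.reflect hk hai hs.reflect (by simpa using hf)
  simp only [formDensity_reflect, neg_zero, Complex.normSq_neg] at hr
  rw [intervalIntegral.integral_comp_neg (fun x => formDensity u br ai f g x), neg_zero, neg_neg]
    at hr
  rw [← intervalIntegral.integral_add_adjacent_intervals (hcont.intervalIntegrable (-d) 0)
    (hcont.intervalIntegrable 0 d)]
  have hw : 0 < Real.cos (u 0 / 2) / Real.sin (u 0 / 2) :=
    div_pos (h.cos_pos 0) (h.sin_pos h.pos)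
  have hT : 0 < Complex.normSq (f 0) + Complex.normSq (g 0) := by
    by_contra! hcon
    have h1 := Complex.normSq_nonneg (f 0)
    have h2 := Complex.normSq_nonneg (g 0)
    exact hne (hs.eq_zero_of_apply_eq_zero h.continuous (t := 0)
      (Complex.normSq_eq_zero.1 (by linarith)) (Complex.normSq_eq_zero.1 (by linarith)) (-d)).1
  nlinarith [mul_pos hw hT]

/-- Off the unit circle the form vanishes on solutions that decay at both ends. -/
theorem mul_form_eq_zero (h : IsBump u d)
    (hs : IsSolPair u (k * br + ai * Complex.I) (br + k * ai * Complex.I) f g)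
    (hg : g (-d) = 0) (hf : f d = 0) :
    k * ∫ x in (-d)..d, formDensity u br ai f g x = 0 := by
  have hcont := continuous_formDensity h.continuous br ai hs.continuous_fst hs.continuous_snd
  have hder : ∀ x, HasDerivAt (fun x => (f x * starRingEnd ℂ (g x)).re)
      (k * formDensity u br ai f g x) x := fun x => by
    refine (hasDerivAt_mul_conj_re (hs.1 x) (hs.2 x)).congr_deriv ?_
    simp only [formDensity, Complex.normSq_apply, Complex.add_re, Complex.add_im, Complex.mul_re,
      Complex.mul_im, Complex.neg_re, Complex.neg_im,
      Complex.I_re, Complex.I_im, Complex.ofReal_re, Complex.ofReal_im, Complex.conj_re,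
      Complex.conj_im]
    ring
  have := intervalIntegral.integral_eq_sub_of_hasDerivAt (a := -d) (b := d)
    (fun x _ => hder x) ((hcont.const_mul k).intervalIntegrable _ _)
  rw [intervalIntegral.integral_const_mul] at this
  simpa [hg, hf] using this

end LeftEstimate

/-! ### The coefficients as functions of the spectral parameter -/

/-- The diagonal coefficient at the spectral parameter `z`. -/
noncomputable def coeffA (z : ℂ) : ℂ := 1 / 4 * (z - 1 / z)

/-- The off-diagonal coefficient at the spectral parameter `z`. -/
noncomputable def coeffB (z : ℂ) : ℂ := 1 / 4 * (z + 1 / z)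

theorem coeffA_im_pos {z : ℂ} (hz : 0 < z.im) : 0 < (coeffA z).im := by
  have hz0 : z ≠ 0 := by rintro rfl; simp at hz
  have hN := Complex.normSq_pos.2 hz0
  have : (coeffA z).im = (z.im + z.im / Complex.normSq z) / 4 := by
    simp [coeffA, Complex.mul_im, Complex.inv_im]
    ring_nf
  rw [this]
  positivity

/-- The ratio `(|z|² - 1) / (|z|² + 1)`. -/
noncomputable def modulusRatio (z : ℂ) : ℝ := (Complex.normSq z - 1) / (Complex.normSq z + 1)

theorem abs_modulusRatio_le (z : ℂ) : |modulusRatio z| ≤ 1 := by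
  have hN := Complex.normSq_nonneg z
  have hp : 0 < Complex.normSq z + 1 := by linarith
  rw [modulusRatio, abs_div, abs_of_pos hp, div_le_one hp, abs_le]
  constructor <;> linarith

/-- The real parts of z ∓ 1/z are Re z·(1 ∓ 1/|z|²), whose quotient is the modulus ratio; the
imaginary parts carry the opposite signs, giving the companion formula for b. -/
theorem coeffA_eq {z : ℂ} (hz : z ≠ 0) :
    coeffA z = modulusRatio z * (coeffB z).re + (coeffA z).im * Complex.I := by
  have hN := Complex.normSq_pos.2 hz
  apply Complex.ext
  · simp [coeffA, coeffB, Complex.mul_re, Complex.inv_re]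
    rw [modulusRatio]
    field_simp
  · simp

theorem coeffB_eq {z : ℂ} (hz : z ≠ 0) :
    coeffB z = (coeffB z).re + modulusRatio z * (coeffA z).im * Complex.I := by
  have hN := Complex.normSq_pos.2 hz
  apply Complex.ext
  · simp
  · simp [coeffA, coeffB, Complex.mul_im, Complex.inv_im]
    rw [modulusRatio]
    field_simp
    ring

theorem norm_exp_I_mul (a : ℂ) (x : ℝ) :
    ‖Complex.exp (Complex.I * a * (x : ℂ))‖ = Real.exp (-(a.im * x)) := by
  rw [Complex.norm_exp]
  congr 1
  simp [Complex.mul_re]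

/-! ### Square integrability as boundary conditions at ±d -/

section Decay

variable {u : ℝ → ℝ} {d : ℝ} {a b : ℂ} {f g : ℝ → ℂ}

/-- To the left of the support |g| grows towards -∞, so it dominates the constant |g(-d)| on a half
line of infinite measure. -/
theorem snd_eq_zero_of_memLp (h : IsBump u d) (hs : IsSolPair u a b f g) (ha : 0 < a.im)
    (hg : MemLp g 2 volume) : g (-d) = 0 := by
  have hle : ∀ x ∈ Set.Iic (-d), ‖g (-d)‖ ≤ ‖g x‖ := fun x hx => by
    have h1 := congrArg norm (hs.snd_mul_exp_eq (convex_Iic (-d)) (fun y hy => h.eq_zero_of_le hy)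
      hx (Set.mem_Iic.2 le_rfl))
    rw [norm_mul, norm_mul, Complex.exp_neg, Complex.exp_neg, norm_inv, norm_inv, norm_exp_I_mul,
      norm_exp_I_mul, ← Real.exp_neg, ← Real.exp_neg, neg_neg, neg_neg] at h1
    have h2 : Real.exp (a.im * x) ≤ Real.exp (a.im * -d) :=
      Real.exp_le_exp.2 (mul_le_mul_of_nonneg_left hx ha.le)
    have h3 : ‖g (-d)‖ * Real.exp (a.im * -d) ≤ ‖g x‖ * Real.exp (a.im * -d) :=
      h1 ▸ mul_le_mul_of_nonneg_left h2 (norm_nonneg _)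
    exact le_of_mul_le_mul_right h3 (Real.exp_pos _)
  have h1 : MemLp (fun _ : ℝ => g (-d)) 2 (volume.restrict (Set.Iic (-d))) :=
    (hg.restrict _).mono aestronglyMeasurable_const
      ((ae_restrict_iff' measurableSet_Iic).2 (Eventually.of_forall hle))
  rw [memLp_const_iff two_ne_zero ENNReal.ofNat_ne_top] at h1
  rcases h1 with h1 | h1
  · exact h1
  · simp at h1

theorem memLp_comp_neg {f : ℝ → ℂ} (hf : MemLp f 2 volume) :
    MemLp (fun x => f (-x)) 2 volume :=
  hf.comp_measurePreserving (Measure.measurePreserving_neg volume)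

theorem fst_eq_zero_of_memLp (h : IsBump u d) (hs : IsSolPair u a b f g) (ha : 0 < a.im)
    (hf : MemLp f 2 volume) : f d = 0 := by
  simpa using snd_eq_zero_of_memLp h.reflect hs.reflect ha (memLp_comp_neg hf).neg

theorem memLp_fst (h : IsBump u d) (hs : IsSolPair u a b f g) (ha : 0 < a.im) (hf : f d = 0) :
    MemLp f 2 volume := by
  have hc := hs.continuous_fst
  rw [memLp_two_iff_integrable_sq_norm hc.aestronglyMeasurable, ← integrableOn_univ]
  have hu : (Set.univ : Set ℝ) = Set.Iic (-d) ∪ (Set.Icc (-d) d ∪ Set.Ici d) := by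
    ext x
    simp only [Set.mem_univ, Set.mem_union, Set.mem_Iic, Set.mem_Icc, Set.mem_Ici, true_iff]
    rcases le_total x (-d) with h1 | h1
    · exact Or.inl h1
    · rcases le_total x d with h2 | h2
      · exact Or.inr (Or.inl ⟨h1, h2⟩)
      · exact Or.inr (Or.inr h2)
  rw [hu]
  refine IntegrableOn.union ?_ (IntegrableOn.union ?_ ?_)
  · have h1 : IntegrableOn (fun x => (‖f (-d)‖ * Real.exp (a.im * d)) ^ 2 *
        Real.exp (2 * a.im * x)) (Set.Iic (-d)) :=
      (integrableOn_exp_mul_Iic (by positivity) _).const_mul _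
    refine h1.congr_fun (fun x hx => ?_) measurableSet_Iic
    have h2 := congrArg norm (hs.fst_mul_exp_eq (convex_Iic (-d)) (fun y hy => h.eq_zero_of_le hy)
      hx (Set.mem_Iic.2 le_rfl))
    rw [norm_mul, norm_mul, norm_exp_I_mul, norm_exp_I_mul] at h2
    have h3 : ‖f x‖ = ‖f (-d)‖ * Real.exp (a.im * d) * Real.exp (a.im * x) := by
      have h4 : ‖f x‖ = ‖f x‖ * Real.exp (-(a.im * x)) * Real.exp (a.im * x) := by
        rw [mul_assoc, ← Real.exp_add]; simp
      rw [h4, h2]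
      simp
    change _ = ‖f x‖ ^ 2
    rw [h3, mul_pow _ (Real.exp (a.im * x)), ← Real.exp_nat_mul]
    push_cast
    ring_nf
  · exact (hc.norm.pow 2).continuousOn.integrableOn_Icc
  · refine integrableOn_zero.congr_fun (fun x hx => ?_) measurableSet_Ici
    have := hs.fst_eq_zero (convex_Ici d) (fun y hy => h.eq_zero_of_ge hy) hx
      (Set.mem_Ici.2 le_rfl) hf
    simp [this]

theorem memLp_snd (h : IsBump u d) (hs : IsSolPair u a b f g) (ha : 0 < a.im) (hg : g (-d) = 0) :
    MemLp g 2 volume := by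
  simpa using memLp_comp_neg (memLp_fst h.reflect hs.reflect ha (by simpa using hg))

end Decay

/-! ### Eigenfunctions, Jost solutions and their Wronskian -/

section Spectral

variable {u : ℝ → ℝ} {d : ℝ} {z : ℂ}

theorem isEigenfunction_iff (h : IsBump u d) (hz : 0 < z.im) (Φ : ℝ → Fin 2 → ℂ) :
    IsEigenfunction u z Φ ↔
      IsSolPair u (coeffA z) (coeffB z) (fun x => Φ x 0) (fun x => Φ x 1) ∧
        Φ (-d) 1 = 0 ∧ Φ d 0 = 0 ∧ Φ (-d) 0 ≠ 0 := by
  have ha := coeffA_im_pos hz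
  rw [IsEigenfunction, isSolution_iff, Fin.forall_fin_two]
  change IsSolPair u (coeffA z) (coeffB z) _ _ ∧ _ ↔ _
  constructor
  · rintro ⟨hs, hne, h0, h1⟩
    have hg := snd_eq_zero_of_memLp h hs ha h1
    refine ⟨hs, hg, fst_eq_zero_of_memLp h hs ha h0, fun hf => hne ?_⟩
    funext x i
    have := hs.eq_zero_of_apply_eq_zero h.continuous hf hg x
    fin_cases i
    · exact this.1
    · exact this.2
  · rintro ⟨hs, hg, hf, hne⟩
    exact ⟨hs, fun h0 => hne (by simp [h0]), memLp_fst h hs ha hf, memLp_snd h hs ha hg⟩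

theorem norm_eq_one_of_isEigenvalue (h : IsBump u d) (hz : 0 < z.im) (hev : IsEigenvalue u z) :
    ‖z‖ = 1 := by
  obtain ⟨hz0, Φ, hΦ⟩ := hev
  obtain ⟨hs, hg, hf, hne⟩ := (isEigenfunction_iff h hz Φ).1 hΦ
  replace hs : IsSolPair u (modulusRatio z * (coeffB z).re + (coeffA z).im * Complex.I)
      ((coeffB z).re + modulusRatio z * (coeffA z).im * Complex.I)
      (fun x => Φ x 0) (fun x => Φ x 1) := by
    rw [← coeffA_eq hz0, ← coeffB_eq hz0]
    exact hs
  have hneg := form_neg h (abs_modulusRatio_le z) (coeffA_im_pos hz).le hs hg hf hne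
  rcases mul_eq_zero.1 (mul_form_eq_zero h hs hg hf) with h0 | h0
  · have hN := Complex.normSq_nonneg z
    rw [modulusRatio, div_eq_zero_iff] at h0
    have h1 : Complex.normSq z = 1 := by rcases h0 with h0 | h0 <;> linarith
    rw [Complex.normSq_eq_norm_sq] at h1
    exact (pow_eq_one_iff_of_nonneg (norm_nonneg z) two_ne_zero).1 h1
  · exact absurd h0 hneg.ne

theorem eigenfunctions_proportional (h : IsBump u d) (hz : 0 < z.im) {Φ Ψ : ℝ → Fin 2 → ℂ}
    (hΦ : IsEigenfunction u z Φ) (hΨ : IsEigenfunction u z Ψ) : ∃ c : ℂ, Ψ = c • Φ := by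
  obtain ⟨hs, hg, -, hne⟩ := (isEigenfunction_iff h hz Φ).1 hΦ
  obtain ⟨hs', hg', -, -⟩ := (isEigenfunction_iff h hz Ψ).1 hΨ
  refine ⟨Ψ (-d) 0 / Φ (-d) 0, ?_⟩
  have := hs'.eq_of_apply_eq h.continuous (hs.const_mul (Ψ (-d) 0 / Φ (-d) 0)) (t := -d)
    (by field_simp) (by simp [hg, hg'])
  funext x i
  fin_cases i
  · exact (this x).1
  · exact (this x).2

theorem isEigenvalue_iff (h : IsBump u d) (hz : 0 < z.im) {f g : ℝ → ℂ}
    (hs : IsSolPair u (coeffA z) (coeffB z) f g) (hf : f (-d) = 1) (hg : g (-d) = 0) :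
    IsEigenvalue u z ↔ f d = 0 := by
  have hz0 : z ≠ 0 := by rintro rfl; simp at hz
  constructor
  · rintro ⟨-, Φ, hΦ⟩
    obtain ⟨hs', hg', hf', hne⟩ := (isEigenfunction_iff h hz Φ).1 hΦ
    have := (hs'.eq_of_apply_eq h.continuous (hs.const_mul (Φ (-d) 0)) (t := -d)
      (by simp [hf]) (by simp [hg, hg']) d).1
    rw [hf'] at this
    exact (mul_eq_zero.1 this.symm).resolve_left hne
  · intro hd
    refine ⟨hz0, fun x => ![f x, g x], (isEigenfunction_iff h hz _).2 ⟨?_, ?_, ?_, ?_⟩⟩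
    · simpa using hs
    · simpa using hg
    · simpa using hd
    · simp [hf]

theorem integral_cos_hasDerivAt (h : IsBump u d) (t x : ℝ) :
    HasDerivAt (fun x => ∫ y in t..x, Real.cos (u y / 2)) (Real.cos (u x / 2)) x := by
  have hu := h.continuous
  have hc : Continuous fun y => Real.cos (u y / 2) := by fun_prop
  exact intervalIntegral.integral_hasDerivAt_right (hc.intervalIntegrable _ _)
    (hc.stronglyMeasurableAtFilter _ _) hc.continuousAt

theorem tendsto_vec_two {l : Filter ℝ} {c : ℝ → ℂ} {f g : ℝ → ℂ} {y : Fin 2 → ℂ}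
    (hf : ∀ᶠ x in l, c x * f x = y 0) (hg : ∀ᶠ x in l, c x * g x = y 1) :
    Tendsto (fun x => c x • ![f x, g x]) l (𝓝 y) := by
  refine tendsto_const_nhds.congr' ?_
  filter_upwards [hf, hg] with x h1 h2
  funext i
  fin_cases i
  · simpa using h1.symm
  · simpa using h2.symm

/-- The exponential factor converts the normalisation at -d into the one at the origin; the Jost
limit is attained exactly for x ≤ -d. -/
theorem isLeftJost (h : IsBump u d) {f g : ℝ → ℂ}
    (hs : IsSolPair u (coeffA z) (coeffB z) f g) (hf : f (-d) = 1) (hg : g (-d) = 0) :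
    IsLeftJost u z fun x =>
      ![Complex.exp (Complex.I * coeffA z * ((∫ y in (-d)..0, Real.cos (u y / 2) : ℝ) : ℂ)) * f x,
        Complex.exp (Complex.I * coeffA z * ((∫ y in (-d)..0, Real.cos (u y / 2) : ℝ) : ℂ)) *
          g x] := by
  refine ⟨(isSolution_iff _ _ _).2 (hs.const_mul _), ?_⟩
  refine tendsto_vec_two ?_ ?_
  · filter_upwards [eventually_le_atBot (-d)] with x hx
    have := mul_exp_eq_of_hasDerivAt (convex_Iic (-d)) (y := f) (k := Complex.I * coeffA z)
      (v := fun x => ∫ y in x..0, Real.cos (u y / 2)) (v' := fun x => -Real.cos (u x / 2))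
      (fun t _ => by
        simp_rw [intervalIntegral.integral_symm 0]
        exact (integral_cos_hasDerivAt h 0 t).neg)
      (fun t ht => (hs.1 t).congr_deriv (by simp [h.eq_zero_of_le ht]))
      (x := x) (x₀ := -d) hx (Set.mem_Iic.2 le_rfl)
    have e : Complex.I / 4 * (z - 1 / z) = Complex.I * coeffA z := by rw [coeffA]; ring
    rw [e, mul_left_comm, mul_comm (Complex.exp (-_)), this, hf, one_mul, ← Complex.exp_add]
    simp
  · filter_upwards [eventually_le_atBot (-d)] with x hx
    have := hs.snd_eq_zero (convex_Iic (-d)) (fun y hy => h.eq_zero_of_le hy) hx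
      (Set.mem_Iic.2 le_rfl) hg
    simp [this]

theorem isRightJost (h : IsBump u d) {f g : ℝ → ℂ}
    (hs : IsSolPair u (coeffA z) (coeffB z) f g) (hf : f d = 0) (hg : g d = 1) :
    IsRightJost u z fun x =>
      ![Complex.exp (Complex.I * coeffA z * ((∫ y in (0 : ℝ)..d, Real.cos (u y / 2) : ℝ) : ℂ)) *
          f x,
        Complex.exp (Complex.I * coeffA z * ((∫ y in (0 : ℝ)..d, Real.cos (u y / 2) : ℝ) : ℂ)) *
          g x] := by
  refine ⟨(isSolution_iff _ _ _).2 (hs.const_mul _), ?_⟩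
  refine tendsto_vec_two ?_ ?_
  · filter_upwards [eventually_ge_atTop d] with x hx
    have := hs.fst_eq_zero (convex_Ici d) (fun y hy => h.eq_zero_of_ge hy) hx
      (Set.mem_Ici.2 le_rfl) hf
    simp [this]
  · filter_upwards [eventually_ge_atTop d] with x hx
    have := mul_exp_eq_of_hasDerivAt (convex_Ici d) (y := g) (k := Complex.I * coeffA z)
      (v := fun x => ∫ y in (0 : ℝ)..x, Real.cos (u y / 2)) (v' := fun x => Real.cos (u x / 2))
      (fun t _ => integral_cos_hasDerivAt h 0 t)
      (fun t ht => (hs.2 t).congr_deriv (by simp [h.eq_zero_of_ge ht]))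
      (x := x) (x₀ := d) hx (Set.mem_Ici.2 le_rfl)
    have e : Complex.I / 4 * (z - 1 / z) = Complex.I * coeffA z := by rw [coeffA]; ring
    rw [e, mul_left_comm, mul_comm (Complex.exp (-_)), this, hg, one_mul, ← Complex.exp_add]
    simp

/-- Evaluate at d, where the right solution is (0, 1) before scaling; the two scaling exponentials
multiply to one over [-d, d]. -/
theorem isJostWronskian (h : IsBump u d) {f g : ℂ × ℂ → ℝ → ℂ}
    (hs : ∀ p, IsSolPair u p.1 p.2 (f p) (g p)) (h0 : ∀ p, f p (-d) = 1 ∧ g p (-d) = 0) :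
    IsJostWronskian u fun z =>
      Complex.exp (Complex.I * coeffA z * ((∫ y in (-d)..d, Real.cos (u y / 2) : ℝ) : ℂ)) *
        f (coeffA z, coeffB z) d := by
  intro z _
  obtain ⟨r, q, -, -, h1, hs'⟩ := exists_solPair u h.continuous d (0, 1)
  have hl := hs (coeffA z, coeffB z)
  have hr := hs' (coeffA z, coeffB z)
  refine ⟨_, _, isLeftJost h hl (h0 _).1 (h0 _).2, isRightJost h hr (h1 _).1 (h1 _).2,
    fun x => ?_⟩
  have hw := wronskian_const hl hr x d
  simp only [h1, mul_one, mul_zero, sub_zero] at hw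
  have hu := h.continuous
  have hc : Continuous fun y => Real.cos (u y / 2) := by fun_prop
  beta_reduce
  rw [← intervalIntegral.integral_add_adjacent_intervals (hc.intervalIntegrable (-d) 0)
    (hc.intervalIntegrable 0 d), ← hw]
  simp only [Matrix.cons_val_zero, Matrix.cons_val_one, Complex.ofReal_add, mul_add,
    Complex.exp_add]
  ring

end Spectral

/-! ### Differentiation in the spectral parameter -/

/-- The product rule at a zero of the first factor needs only continuity of the second. -/
theorem hasDerivAt_mul_of_eq_zero {𝕜 : Type*} [NontriviallyNormedField 𝕜] [NormedAlgebra 𝕜 ℂ]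
    {φ J : 𝕜 → ℂ} {φ' : ℂ} {t : 𝕜} (hφ : HasDerivAt φ φ' t) (h0 : φ t = 0)
    (hJ : ContinuousAt J t) : HasDerivAt (fun x => φ x * J x) (φ' * J t) t := by
  rw [hasDerivAt_iff_tendsto_slope] at hφ ⊢
  refine (hφ.mul (hJ.tendsto.mono_left nhdsWithin_le_nhds)).congr fun x => ?_
  simp [slope, h0]

section Wronskian

variable {u : ℝ → ℝ} {d : ℝ} {f g : ℂ × ℂ → ℝ → ℂ}

/-- The derivative in the spectral parameter of the Wronskian of two members of a family of
solutions. -/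
theorem hasDerivAt_wronskian {𝕜 : Type*} [NontriviallyNormedField 𝕜] [NormedAlgebra 𝕜 ℂ]
    (hu : Continuous u) (hf : Continuous (Function.uncurry f))
    (hg : Continuous (Function.uncurry g)) (hs : ∀ p, IsSolPair u p.1 p.2 (f p) (g p))
    (h0 : ∀ p, f p (-d) = 1 ∧ g p (-d) = 0)
    {A B : 𝕜 → ℂ} {A' B' : ℂ} {t : 𝕜} (hA : HasDerivAt A A' t) (hB : HasDerivAt B B' t) :
    HasDerivAt (fun x => f (A x, B x) d * g (A t, B t) d - g (A x, B x) d * f (A t, B t) d)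
      (∫ x in (-d)..d, (-A' * (Complex.I * (Real.cos (u x / 2) : ℂ) *
          (2 * f (A t, B t) x * g (A t, B t) x)) +
        B' * (Complex.I * (Real.sin (u x / 2) : ℂ) *
          (g (A t, B t) x ^ 2 - f (A t, B t) x ^ 2)))) t := by
  set p : ℂ × ℂ := (A t, B t) with hp
  have hfp : Continuous (f p) := (hs p).continuous_fst
  have hgp : Continuous (g p) := (hs p).continuous_snd
  let j₁ : ℂ × ℂ → ℝ → ℂ := fun q x =>
    Complex.I * (Real.cos (u x / 2) : ℂ) * (f q x * g p x + g q x * f p x)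
  let j₂ : ℂ × ℂ → ℝ → ℂ := fun q x =>
    Complex.I * (Real.sin (u x / 2) : ℂ) * (g q x * g p x - f q x * f p x)
  have hf' : Continuous fun q : (ℂ × ℂ) × ℝ => f q.1 q.2 := hf
  have hg' : Continuous fun q : (ℂ × ℂ) × ℝ => g q.1 q.2 := hg
  have hj₁ : Continuous (Function.uncurry j₁) := by
    simp only [Function.uncurry_def, j₁]
    fun_prop
  have hj₂ : Continuous (Function.uncurry j₂) := by
    simp only [Function.uncurry_def, j₂]
    fun_prop
  have hJ₁ := intervalIntegral.continuous_parametric_intervalIntegral_of_continuous'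
    (μ := volume) hj₁ (-d) d
  have hJ₂ := intervalIntegral.continuous_parametric_intervalIntegral_of_continuous'
    (μ := volume) hj₂ (-d) d
  have hcurve : ContinuousAt (fun x => (A x, B x)) t := hA.continuousAt.prodMk hB.continuousAt
  have hint₁ : ∀ q, IntervalIntegrable (j₁ q) volume (-d) d := fun q =>
    (hj₁.comp (Continuous.prodMk_right q)).intervalIntegrable _ _
  have hint₂ : ∀ q, IntervalIntegrable (j₂ q) volume (-d) d := fun q =>
    (hj₂.comp (Continuous.prodMk_right q)).intervalIntegrable _ _
  -- The Wronskian vanishes at -d since all solutions share their data there. Its value at d is then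
  -- linear in the parameter increments, with coefficients continuous in q, so the solutions need
  -- not be differentiated in the parameter.
  have hform : ∀ q : ℂ × ℂ, f q d * g p d - g q d * f p d =
      -(q.1 - A t) * (∫ x in (-d)..d, j₁ q x) + (q.2 - B t) * ∫ x in (-d)..d, j₂ q x := by
    intro q
    have h1 := intervalIntegral.integral_eq_sub_of_hasDerivAt (a := -d) (b := d)
      (fun x _ => wronskian_hasDerivAt (hs q) (hs p) x)
      (((hint₁ q).const_mul _).add ((hint₂ q).const_mul _))
    rw [intervalIntegral.integral_add ((hint₁ q).const_mul _) ((hint₂ q).const_mul _),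
      intervalIntegral.integral_const_mul, intervalIntegral.integral_const_mul] at h1
    simp only [(h0 _).1, (h0 _).2, mul_zero, zero_mul, sub_zero] at h1
    exact h1.symm
  have hD := (hasDerivAt_mul_of_eq_zero (hA.sub_const (A t)).neg (by simp)
      (ContinuousAt.comp (f := fun x => (A x, B x)) (hJ₁.continuousAt) hcurve)).add
    (hasDerivAt_mul_of_eq_zero (hB.sub_const (B t)) (by simp)
      (ContinuousAt.comp (f := fun x => (A x, B x)) (hJ₂.continuousAt) hcurve))
  simp only [hform]
  refine hD.congr_deriv ?_
  simp only [Function.comp_apply]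
  rw [intervalIntegral.integral_add, intervalIntegral.integral_const_mul,
    intervalIntegral.integral_const_mul]
  · congr 2
    · exact intervalIntegral.integral_congr fun x _ => by simp only [j₁, hp]; ring
    · exact intervalIntegral.integral_congr fun x _ => by simp only [j₂, hp]; ring
  · exact Continuous.intervalIntegrable (by fun_prop) _ _
  · exact Continuous.intervalIntegrable (by fun_prop) _ _

/-- On the unit circle the first component is real and the second one imaginary. -/
theorem real_imaginary (hu : Continuous u) {a b : ℝ} {f g : ℝ → ℂ}
    (hs : IsSolPair u (Complex.I * a) b f g) {t : ℝ} (hf : f t = 1) (hg : g t = 0) (x : ℝ) :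
    (f x).im = 0 ∧ (g x).re = 0 := by
  -- The conjugated solution (conj f, -conj g) has the same data at t, hence equals (f, g).
  have := hs.conj.eq_of_apply_eq hu hs (t := t) (by simp [hf]) (by simp [hg]) x
  exact ⟨Complex.conj_eq_iff_im.1 this.1, by
    have := congrArg Complex.re this.2
    simp only [Complex.neg_re, Complex.conj_re] at this
    linarith⟩

/-- The derivative of the Wronskian is expressed by the quadratic form. -/
theorem integral_eq_form {a b : ℝ} {f g : ℝ → ℂ} (hr : ∀ x, (f x).im = 0 ∧ (g x).re = 0)
    (w : ℂ) :
    ∫ x in (-d)..d, (-(w * b) * (Complex.I * (Real.cos (u x / 2) : ℂ) * (2 * f x * g x)) +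
      (w * (Complex.I * a)) * (Complex.I * (Real.sin (u x / 2) : ℂ) * (g x ^ 2 - f x ^ 2))) =
      -(w * ((∫ x in (-d)..d, formDensity u b a f g x : ℝ) : ℂ)) := by
  rw [← intervalIntegral.integral_ofReal, ← intervalIntegral.integral_const_mul,
    ← intervalIntegral.integral_neg]
  refine intervalIntegral.integral_congr fun x _ => ?_
  obtain ⟨h1, h2⟩ := hr x
  have e1 : f x = ((f x).re : ℂ) := Complex.ext rfl (by simpa using h1)
  have e2 : g x = Complex.I * ((g x).im : ℂ) := Complex.ext (by simpa using h2) (by simp)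
  have e3 : formDensity u b a f g x = -(2 * b * Real.cos (u x / 2) * ((f x).re * (g x).im)) -
      a * Real.sin (u x / 2) * ((f x).re ^ 2 + (g x).im ^ 2) := by
    simp only [formDensity, Complex.normSq_apply, Complex.mul_im, Complex.conj_re, Complex.conj_im,
      h1, h2]
    ring
  rw [e3, e1, e2]
  push_cast [Complex.ofReal_re]
  simp only [Complex.mul_im, Complex.I_re, Complex.I_im, Complex.ofReal_re, Complex.ofReal_im]
  ring_nf
  simp only [Complex.I_sq, show Complex.I ^ 4 = 1 from Complex.I_pow_four]
  ring

end Wronskian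

/-! ### The unit circle and simplicity of eigenvalues -/

theorem coeffA_hasDerivAt {z : ℂ} (hz : z ≠ 0) : HasDerivAt coeffA (coeffB z / z) z := by
  have h : HasDerivAt (fun z : ℂ => 1 / 4 * (z - z⁻¹)) _ z :=
    ((hasDerivAt_id z).sub (hasDerivAt_inv hz)).const_mul (1 / 4 : ℂ)
  simp only [← one_div] at h
  refine HasDerivAt.congr_deriv (f := coeffA) h ?_
  rw [coeffB]
  field_simp
  ring

theorem coeffB_hasDerivAt {z : ℂ} (hz : z ≠ 0) : HasDerivAt coeffB (coeffA z / z) z := by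
  have h : HasDerivAt (fun z : ℂ => 1 / 4 * (z + z⁻¹)) _ z :=
    ((hasDerivAt_id z).add (hasDerivAt_inv hz)).const_mul (1 / 4 : ℂ)
  simp only [← one_div] at h
  refine HasDerivAt.congr_deriv (f := coeffB) h ?_
  rw [coeffA]
  field_simp
  ring

theorem coeffA_exp (θ : ℝ) : coeffA (Complex.exp (θ * Complex.I)) =
    Complex.I * ((Real.sin θ / 2 : ℝ) : ℂ) := by
  rw [coeffA, one_div (Complex.exp _), ← Complex.exp_neg, ← neg_mul]
  push_cast
  rw [Complex.sin]
  linear_combination (Complex.exp (θ * Complex.I) - Complex.exp (-θ * Complex.I)) / 4 *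
    Complex.I_sq

theorem coeffB_exp (θ : ℝ) : coeffB (Complex.exp (θ * Complex.I)) =
    ((Real.cos θ / 2 : ℝ) : ℂ) := by
  rw [coeffB, one_div (Complex.exp _), ← Complex.exp_neg, ← neg_mul]
  push_cast
  rw [Complex.cos]
  ring

theorem exists_eq_exp {z : ℂ} (hz : ‖z‖ = 1) (hre : 0 < z.re) (him : 0 < z.im) :
    ∃ θ ∈ Set.Ioo 0 (Real.pi / 2), z = Complex.exp (θ * Complex.I) := by
  refine ⟨z.arg, ⟨?_, ?_⟩, ?_⟩
  · refine lt_of_le_of_ne (Complex.arg_nonneg_iff.2 him.le) fun h => ?_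
    exact him.ne' (Complex.arg_eq_zero_iff.1 h.symm).2
  · exact (abs_lt.1 (Complex.abs_arg_lt_pi_div_two_iff.2 (Or.inl hre))).2
  · have := Complex.norm_mul_exp_arg_mul_I z
    rw [hz] at this
    simpa using this.symm

theorem exp_re_pos_im_pos {θ : ℝ} (hθ : θ ∈ Set.Ioo 0 (Real.pi / 2)) :
    0 < (Complex.exp (θ * Complex.I)).re ∧ 0 < (Complex.exp (θ * Complex.I)).im := by
  rw [Complex.exp_ofReal_mul_I_re, Complex.exp_ofReal_mul_I_im]
  exact ⟨Real.cos_pos_of_mem_Ioo ⟨by linarith [hθ.1, Real.pi_pos], hθ.2⟩,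
    Real.sin_pos_of_pos_of_lt_pi hθ.1 (by linarith [hθ.2, Real.pi_pos])⟩

/-- `form_neg` on the unit circle. -/
theorem form_neg_of_circle {u : ℝ → ℝ} {d : ℝ} (h : IsBump u d) {a b : ℝ} (ha : 0 ≤ a)
    {f g : ℝ → ℂ} (hs : IsSolPair u (Complex.I * a) b f g) (hg : g (-d) = 0) (hf : f d = 0)
    (hne : f (-d) ≠ 0) : ∫ x in (-d)..d, formDensity u b a f g x < 0 := by
  refine form_neg (k := 0) h (by simp) ha ?_ hg hf hne
  simpa [mul_comm] using hs

theorem isSimpleEigenvalue {u : ℝ → ℝ} {d : ℝ} (h : IsBump u d) {z : ℂ} (hre : 0 < z.re)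
    (hz : 0 < z.im) (hev : IsEigenvalue u z) : ‖z‖ = 1 ∧ IsSimpleEigenvalue u z := by
  have hnorm := norm_eq_one_of_isEigenvalue h hz hev
  refine ⟨hnorm, hev, fun Φ Ψ hΦ hΨ => eigenfunctions_proportional h hz hΦ hΨ, ?_⟩
  have hz0 : z ≠ 0 := hev.1
  obtain ⟨θ, hθ, hzθ⟩ := exists_eq_exp hnorm hre hz
  obtain ⟨f, g, hf, hg, h0, hs⟩ := exists_solPair u h.continuous (-d) (1, 0)
  have hsz := hs (coeffA z, coeffB z)
  have hd := (isEigenvalue_iff h hz hsz (h0 _).1 (h0 _).2).1 hev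
  have hgd : g (coeffA z, coeffB z) d ≠ 0 := fun hgd => by
    have := (hsz.eq_zero_of_apply_eq_zero h.continuous hd hgd (-d)).1
    rw [(h0 _).1] at this
    exact one_ne_zero this
  refine ⟨_, isJostWronskian h hs h0, by simp [hd], ?_⟩
  have hD := hasDerivAt_wronskian h.continuous hf hg hs h0 (coeffA_hasDerivAt hz0)
    (coeffB_hasDerivAt hz0)
  have ea : coeffA z = Complex.I * ((Real.sin θ / 2 : ℝ) : ℂ) := by rw [hzθ, coeffA_exp]
  have eb : coeffB z = ((Real.cos θ / 2 : ℝ) : ℂ) := by rw [hzθ, coeffB_exp]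
  have hsz' : IsSolPair u (Complex.I * ((Real.sin θ / 2 : ℝ) : ℂ)) ((Real.cos θ / 2 : ℝ) : ℂ)
      (f (coeffA z, coeffB z)) (g (coeffA z, coeffB z)) := by
    rw [← ea, ← eb]
    exact hsz
  -- The factor is 1/z because a' = b/z and b' = a/z.
  have hint := integral_eq_form (u := u) (d := d) (a := Real.sin θ / 2)
    (b := Real.cos θ / 2)
    (real_imaginary h.continuous hsz' (h0 _).1 (h0 _).2) (1 / z)
  have hneg := form_neg_of_circle h (by
    have := Real.sin_pos_of_pos_of_lt_pi hθ.1 (by linarith [hθ.2, Real.pi_pos])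
    positivity) hsz' (h0 _).2 hd (by rw [(h0 _).1]; exact one_ne_zero)
  rw [← ea, ← eb, one_div_mul_eq_div, one_div_mul_eq_div] at hint
  rw [hint] at hD
  simp only [hd, mul_zero, sub_zero] at hD
  -- As f(d) = 0 at the eigenvalue, the differentiated Wronskian is f(·, d) times the nonzero
  -- constant g(d).
  have hF := (hD.div_const (g (coeffA z, coeffB z) d)).congr_of_eventuallyEq
    (f₁ := fun z => f (coeffA z, coeffB z) d)
    (Eventually.of_forall fun x => (mul_div_cancel_right₀ _ hgd).symm)
  have hE : HasDerivAt (fun z => Complex.exp (Complex.I * coeffA z *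
      ((∫ y in (-d)..d, Real.cos (u y / 2) : ℝ) : ℂ))) _ z :=
    (((coeffA_hasDerivAt hz0).const_mul Complex.I).mul_const _).cexp
  refine ⟨_, hE.mul hF, ?_⟩
  rw [hd, mul_zero, zero_add]
  refine mul_ne_zero (Complex.exp_ne_zero _) (div_ne_zero (neg_ne_zero.2 (mul_ne_zero ?_ ?_)) hgd)
  · exact one_div_ne_zero hz0
  · exact Complex.ofReal_ne_zero.2 hneg.ne

/-! ### The Prüfer angle -/

/-- The logarithmic derivative of f + g is explicit, and f + g has no zero since f is real and g
imaginary. Integrating it gives a continuous argument without choosing a branch. -/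
theorem polar_form {u : ℝ → ℝ} (hu : Continuous u) {d a b : ℝ} {f g : ℝ → ℂ}
    (hs : IsSolPair u (Complex.I * a) b f g) (hf : f (-d) = 1) (hg : g (-d) = 0) :
    (∀ x, f x + g x ≠ 0) ∧
      f d + g d = Complex.exp (∫ x in (-d)..d,
        (a * Real.cos (u x / 2) * ((f x - g x) / (f x + g x)) +
          Complex.I * b * Real.sin (u x / 2))) := by
  have hr := real_imaginary hu hs hf hg
  have hne : ∀ x, f x + g x ≠ 0 := fun x hx => by
    obtain ⟨h1, h2⟩ := hr x
    have e1 : (f x).re = 0 := by simpa [h2] using congrArg Complex.re hx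
    have e2 : (g x).im = 0 := by simpa [h1] using congrArg Complex.im hx
    have := (hs.eq_zero_of_apply_eq_zero hu (t := x) (Complex.ext e1 h1) (Complex.ext h2 e2)
      (-d)).1
    rw [hf] at this
    exact one_ne_zero this
  refine ⟨hne, ?_⟩
  have hfc := hs.continuous_fst
  have hgc := hs.continuous_snd
  set l : ℝ → ℂ := fun x => a * Real.cos (u x / 2) * ((f x - g x) / (f x + g x)) +
    Complex.I * b * Real.sin (u x / 2) with hl
  have hlc : Continuous l := by
    have h1 : Continuous fun x => (f x - g x) / (f x + g x) := (hfc.sub hgc).div (hfc.add hgc) hne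
    fun_prop
  have hL : ∀ x, HasDerivAt (fun x => ∫ t in (-d)..x, l t) (l x) x := fun x =>
    intervalIntegral.integral_hasDerivAt_right (hlc.intervalIntegrable _ _)
      (hlc.stronglyMeasurableAtFilter _ _) hlc.continuousAt
  have hw : ∀ x, HasDerivAt (fun x => f x + g x) (l x * (f x + g x)) x := fun x => by
    refine ((hs.1 x).add (hs.2 x)).congr_deriv ?_
    have := hne x
    simp only [hl]
    field_simp
    linear_combination (-(a : ℂ) * Real.cos (u x / 2) * (f x - g x)) * Complex.I_sq
  have := eq_of_hasDerivAt_zero_of_convex convex_univ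
    (F := fun x => (f x + g x) * Complex.exp (-∫ t in (-d)..x, l t))
    (fun x _ => ((hw x).mul (hL x).neg.cexp).congr_deriv (by ring))
    (Set.mem_univ d) (Set.mem_univ (-d))
  simp only [hf, hg, intervalIntegral.integral_same, neg_zero, Complex.exp_zero, add_zero,
    mul_one, Complex.exp_neg] at this
  rwa [mul_inv_eq_one₀ (Complex.exp_ne_zero _)] at this

/-- A negative derivative of `r sin (η - η θ)` with `r > 0` makes `η` decrease through `θ`. -/
theorem decreasing_through {η r : ℝ → ℝ} (hη : Continuous η) (hr : ∀ t, 0 < r t) {θ B : ℝ}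
    (hB : B < 0) (hD : HasDerivAt (fun t => r t * Real.sin (η t - η θ)) B θ) :
    (∀ᶠ t in 𝓝[>] θ, η t < η θ) ∧ ∀ᶠ t in 𝓝[<] θ, η θ < η t := by
  have hslope := (hasDerivAt_iff_tendsto_slope.1 hD).eventually (eventually_lt_nhds hB)
  -- Within distance π the sine has the sign of the difference of angles.
  have hnear : ∀ᶠ t in 𝓝 θ, |η t - η θ| < Real.pi := by
    have := Metric.continuousAt_iff'.1 (hη.continuousAt (x := θ)) Real.pi Real.pi_pos
    simpa [Real.dist_eq] using this
  constructor
  · filter_upwards [hslope.filter_mono (nhdsWithin_mono θ fun y (hy : θ < y) => hy.ne'),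
      hnear.filter_mono nhdsWithin_le_nhds, self_mem_nhdsWithin] with t h1 h2 (h3 : θ < t)
    by_contra! hcon
    have h4 := Real.sin_nonneg_of_nonneg_of_le_pi (sub_nonneg.2 hcon) (abs_lt.1 h2).2.le
    rw [slope_def_field, sub_self, Real.sin_zero, mul_zero, sub_zero] at h1
    exact absurd h1 (not_lt.2 (div_nonneg (mul_nonneg (hr t).le h4) (by linarith)))
  · filter_upwards [hslope.filter_mono (nhdsWithin_mono θ fun y (hy : y < θ) => hy.ne),
      hnear.filter_mono nhdsWithin_le_nhds, self_mem_nhdsWithin] with t h1 h2 (h3 : t < θ)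
    by_contra! hcon
    have h4 := Real.sin_nonpos_of_nonpos_of_neg_pi_le (sub_nonpos.2 hcon) (abs_lt.1 h2).1.le
    rw [slope_def_field, sub_self, Real.sin_zero, mul_zero, sub_zero] at h1
    exact absurd h1 (not_lt.2 (div_nonneg_of_nonpos
      (mul_nonpos_of_nonneg_of_nonpos (hr t).le h4) (by linarith)))

theorem isSolPair_of_zero_offDiag {u : ℝ → ℝ} {a : ℂ} {f g : ℝ → ℂ} (hs : IsSolPair u a 0 f g) :
    IsSolPair u a 0 f (fun x => -g x) :=
  ⟨fun x => (hs.1 x).congr_deriv (by ring), fun x => (hs.2 x).neg.congr_deriv (by ring)⟩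

/-- The Prüfer angle at the right end of the support, as a function of the argument of the spectral
parameter on the unit circle. -/
theorem exists_angle {u : ℝ → ℝ} {d : ℝ} (h : IsBump u d) :
    ∃ η : ℝ → ℝ, Continuous η ∧ η 0 = (∫ x in (-d)..d, Real.sin (u x / 2)) / 2 ∧
      η (Real.pi / 2) = 0 ∧
      (∀ θ ∈ Set.Ioo 0 (Real.pi / 2),
        (IsEigenvalue u (Complex.exp (θ * Complex.I)) ↔ Real.cos (η θ) = 0)) ∧
      ∀ θ ∈ Set.Ico 0 (Real.pi / 2), Real.cos (η θ) = 0 →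
        (∀ᶠ t in 𝓝[>] θ, η t < η θ) ∧ ∀ᶠ t in 𝓝[<] θ, η θ < η t := by
  have hu := h.continuous
  obtain ⟨f, g, hf, hg, h0, hs⟩ := exists_solPair u hu (-d) (1, 0)
  let A : ℝ → ℂ := fun θ => Complex.I * ((Real.sin θ / 2 : ℝ) : ℂ)
  let B : ℝ → ℂ := fun θ => ((Real.cos θ / 2 : ℝ) : ℂ)
  have hsc : ∀ θ, IsSolPair u (Complex.I * ((Real.sin θ / 2 : ℝ) : ℂ))
      ((Real.cos θ / 2 : ℝ) : ℂ) (f (A θ, B θ)) (g (A θ, B θ)) := fun θ => hs (A θ, B θ)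
  have hpolar := fun θ => polar_form hu (hsc θ) (h0 _).1 (h0 _).2
  let l : ℝ → ℝ → ℂ := fun θ x =>
    ((Real.sin θ / 2 : ℝ) : ℂ) * Real.cos (u x / 2) *
      ((f (A θ, B θ) x - g (A θ, B θ) x) / (f (A θ, B θ) x + g (A θ, B θ) x)) +
      Complex.I * ((Real.cos θ / 2 : ℝ) : ℂ) * Real.sin (u x / 2)
  let Λ : ℝ → ℂ := fun θ => ∫ x in (-d)..d, l θ x
  have hAB : Continuous fun q : ℝ × ℝ => ((A q.1, B q.1), q.2) := by
    simp only [A, B]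
    fun_prop
  have hf' : Continuous fun q : ℝ × ℝ => f (A q.1, B q.1) q.2 := hf.comp hAB
  have hg' : Continuous fun q : ℝ × ℝ => g (A q.1, B q.1) q.2 := hg.comp hAB
  have hl : Continuous (Function.uncurry l) := by
    have h1 : Continuous fun q : ℝ × ℝ => (f (A q.1, B q.1) q.2 - g (A q.1, B q.1) q.2) /
        (f (A q.1, B q.1) q.2 + g (A q.1, B q.1) q.2) :=
      (hf'.sub hg').div (hf'.add hg') fun q => (hpolar q.1).1 q.2
    simp only [Function.uncurry_def, l]
    fun_prop
  have hΛ : Continuous Λ :=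
    intervalIntegral.continuous_parametric_intervalIntegral_of_continuous' hl (-d) d
  have hexp : ∀ θ, f (A θ, B θ) d + g (A θ, B θ) d = Complex.exp (Λ θ) := fun θ => (hpolar θ).2
  have hreal := fun θ => real_imaginary hu (hsc θ) (h0 _).1 (h0 _).2
  have hfd : ∀ θ, f (A θ, B θ) d =
      ((Real.exp (Λ θ).re * Real.cos (Λ θ).im : ℝ) : ℂ) := fun θ => by
    have := congrArg Complex.re (hexp θ)
    rw [Complex.add_re, (hreal θ d).2, add_zero, Complex.exp_re] at this
    exact Complex.ext (by simpa only [Complex.ofReal_re] using this)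
      (by simpa only [Complex.ofReal_im] using (hreal θ d).1)
  have hgd : ∀ θ, g (A θ, B θ) d =
      Complex.I * ((Real.exp (Λ θ).re * Real.sin (Λ θ).im : ℝ) : ℂ) := fun θ => by
    have := congrArg Complex.im (hexp θ)
    rw [Complex.add_im, (hreal θ d).1, zero_add, Complex.exp_im] at this
    exact Complex.ext (by simpa using (hreal θ d).2)
      (by rw [this, Complex.I_mul_im, Complex.ofReal_re])
  have hzero : ∀ θ, f (A θ, B θ) d = 0 ↔ Real.cos (Λ θ).im = 0 := fun θ => by
    rw [hfd, Complex.ofReal_eq_zero, mul_eq_zero]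
    simp [Real.exp_ne_zero]
  refine ⟨fun θ => (Λ θ).im, Complex.continuous_im.comp hΛ, ?_, ?_, ?_, ?_⟩
  · have : Λ 0 = Complex.I * (((∫ x in (-d)..d, Real.sin (u x / 2)) / 2 : ℝ) : ℂ) := by
      simp only [Λ, l, Real.sin_zero, Real.cos_zero]
      rw [← intervalIntegral.integral_div, ← intervalIntegral.integral_ofReal,
        ← intervalIntegral.integral_const_mul]
      refine intervalIntegral.integral_congr fun x _ => ?_
      push_cast
      ring
    simp only [this, Complex.mul_im, Complex.I_re, Complex.I_im, Complex.ofReal_re, zero_mul,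
      one_mul, zero_add]
  · have hs' := hsc (Real.pi / 2)
    -- At θ = π/2 the system decouples, so (f, -g) is a solution with the same data and g = 0; the
    -- exponent is then real.
    have hg0 : ∀ x, g (A (Real.pi / 2), B (Real.pi / 2)) x = 0 := fun x => by
      rw [show ((Real.cos (Real.pi / 2) / 2 : ℝ) : ℂ) = 0 by simp] at hs'
      have := (hs'.eq_of_apply_eq hu (isSolPair_of_zero_offDiag hs') (t := -d) rfl
        (by simp [(h0 _).2]) x).2
      exact self_eq_neg.1 this
    have : Λ (Real.pi / 2) = ((∫ x in (-d)..d, Real.cos (u x / 2) / 2 : ℝ) : ℂ) := by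
      simp only [Λ]
      rw [← intervalIntegral.integral_ofReal]
      refine intervalIntegral.integral_congr fun x _ => ?_
      have hne := (hpolar (Real.pi / 2)).1 x
      simp only [l, hg0, add_zero, sub_zero] at hne ⊢
      rw [div_self hne, Real.cos_pi_div_two, Real.sin_pi_div_two]
      push_cast
      ring
    simp only [this, Complex.ofReal_im]
  · intro θ hθ
    have hz := (exp_re_pos_im_pos hθ).2
    rw [← hzero θ]
    refine isEigenvalue_iff h hz (g := g (A θ, B θ)) ?_ (h0 _).1 (h0 _).2
    rw [coeffA_exp, coeffB_exp]
    exact hsc θ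
  -- The endpoint θ = 0, where a = 0, is included: it rules out that a level equal to η(0) is
  -- attained again later.
  · intro θ hθ hcos
    have hsin : 0 ≤ Real.sin θ / 2 := div_nonneg
      (Real.sin_nonneg_of_nonneg_of_le_pi hθ.1 (by linarith [hθ.2, Real.pi_pos])) zero_le_two
    have hneg := form_neg_of_circle h hsin (hsc θ) (h0 _).2 ((hzero θ).2 hcos)
      (by rw [(h0 _).1]; exact one_ne_zero)
    have hA : HasDerivAt A (Complex.I * ((Real.cos θ / 2 : ℝ) : ℂ)) θ :=
      (((Real.hasDerivAt_sin θ).div_const 2).ofReal_comp).const_mul Complex.I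
    have hB : HasDerivAt B (Complex.I * (Complex.I * ((Real.sin θ / 2 : ℝ) : ℂ))) θ := by
      refine (((Real.hasDerivAt_cos θ).div_const 2).ofReal_comp).congr_deriv ?_
      push_cast
      linear_combination (-(Complex.sin θ) / 2) * Complex.I_sq
    have hD := hasDerivAt_wronskian hu hf hg hs h0 hA hB
    rw [integral_eq_form (hreal θ) Complex.I] at hD
    -- The Wronskian is i·r·sin(η(θ) - η(t)), so multiplying by i gives r·sin(η(t) - η(θ)), with
    -- derivative the form itself.
    have hD2 := Complex.reCLM.hasFDerivAt.comp_hasDerivAt θ (hD.const_mul Complex.I)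
    refine decreasing_through (η := fun θ => (Λ θ).im)
      (r := fun t => Real.exp (Λ t).re * Real.exp (Λ θ).re)
      (Complex.continuous_im.comp hΛ) (fun t => by positivity) hneg ?_
    refine (hD2.congr_deriv ?_).congr_of_eventuallyEq (Eventually.of_forall fun t => ?_)
    · rw [mul_neg, ← mul_assoc, Complex.I_mul_I]
      simp
    · simp only [Function.comp_apply, Complex.reCLM_apply]
      rw [hfd, hfd, hgd, hgd, Real.sin_sub]
      simp only [Complex.mul_re, Complex.mul_im, Complex.sub_re, Complex.sub_im, Complex.I_re,
        Complex.I_im, Complex.ofReal_re, Complex.ofReal_im]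
      ring

/-! ### Counting level crossings -/

section Counting

variable {η : ℝ → ℝ} {β ℓ : ℝ}

theorem le_of_crossing (hη : Continuous η)
    (hcross : ∀ θ ∈ Set.Ico 0 β, η θ = ℓ → ∀ᶠ t in 𝓝[>] θ, η t < ℓ)
    {θ : ℝ} (hθ : θ ∈ Set.Ico 0 β) (he : η θ = ℓ) {t : ℝ} (ht : t ∈ Set.Icc θ β) : η t ≤ ℓ := by
  have hcl : IsClosed {t | η t ≤ ℓ} := isClosed_le hη continuous_const
  refine IsClosed.Icc_subset_of_forall_mem_nhdsWithin (s := {t | η t ≤ ℓ})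
    (hcl.inter isClosed_Icc) he.le (fun x hx => ?_) ht
  rcases lt_or_eq_of_le (show η x ≤ ℓ from hx.1) with h1 | h1
  · exact mem_nhdsWithin_of_mem_nhds
      (mem_of_superset ((isOpen_lt hη continuous_const).mem_nhds h1) fun y (hy : η y < ℓ) => hy.le)
  · exact (hcross x ⟨hθ.1.trans hx.2.1, hx.2.2⟩ h1).mono fun y hy => hy.le

/-- After one crossing η stays at or below ℓ, whereas a second one needs values above ℓ just before
it. -/
theorem crossing_unique (hη : Continuous η)
    (hcross : ∀ θ ∈ Set.Ico 0 β, η θ = ℓ →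
      (∀ᶠ t in 𝓝[>] θ, η t < ℓ) ∧ ∀ᶠ t in 𝓝[<] θ, ℓ < η t)
    {θ t : ℝ} (hθ : θ ∈ Set.Ico 0 β) (ht : t ∈ Set.Ico 0 β) (he : η θ = ℓ) (he' : η t = ℓ) :
    ¬ θ < t := by
  intro hlt
  have h1 := (hcross t ht he').2
  have h2 : ∀ᶠ y in 𝓝[<] t, y ∈ Set.Ioo θ t := Ioo_mem_nhdsLT hlt
  obtain ⟨y, hy1, hy2⟩ := (h1.and h2).exists
  exact absurd (le_of_crossing hη (fun θ hθ he => (hcross θ hθ he).1) hθ he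
    ⟨hy2.1.le, hy2.2.le.trans ht.2.le⟩) (not_le.2 hy1)

/-- Just before θ the value exceeds ℓ; starting at or below ℓ would produce an earlier crossing. -/
theorem lt_apply_zero_of_crossing (hη : Continuous η)
    (hcross : ∀ θ ∈ Set.Ico 0 β, η θ = ℓ →
      (∀ᶠ t in 𝓝[>] θ, η t < ℓ) ∧ ∀ᶠ t in 𝓝[<] θ, ℓ < η t)
    {θ : ℝ} (hθ : θ ∈ Set.Ioo 0 β) (he : η θ = ℓ) : ℓ < η 0 := by
  by_contra! hle
  have h1 := (hcross θ ⟨hθ.1.le, hθ.2⟩ he).2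
  have h2 : ∀ᶠ y in 𝓝[<] θ, y ∈ Set.Ioo 0 θ := Ioo_mem_nhdsLT hθ.1
  obtain ⟨y, hy1, hy2⟩ := (h1.and h2).exists
  obtain ⟨t, ht, hte⟩ := intermediate_value_Icc hy2.1.le hη.continuousOn ⟨hle, hy1.le⟩
  have hty : t < θ := ht.2.trans_lt hy2.2
  exact crossing_unique hη hcross ⟨ht.1, hty.trans hθ.2⟩ ⟨hθ.1.le, hθ.2⟩ hte he hty

theorem cos_level (k : ℕ) : Real.cos (Real.pi / 2 + k * Real.pi) = 0 := by
  rw [Real.cos_add_nat_mul_pi, Real.cos_pi_div_two, mul_zero]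

/-- The zeros of `cos ∘ η` are counted by the levels between the boundary values of `η`. -/
theorem encard_zeros (hβ : 0 < β) (hη : Continuous η) (hend : η β = 0)
    (hcross : ∀ θ ∈ Set.Ico 0 β, Real.cos (η θ) = 0 →
      (∀ᶠ t in 𝓝[>] θ, η t < η θ) ∧ ∀ᶠ t in 𝓝[<] θ, η θ < η t)
    {N : ℕ} (hN : ∀ k : ℕ, k < N ↔ Real.pi / 2 + k * Real.pi < η 0) :
    {θ | θ ∈ Set.Ioo 0 β ∧ Real.cos (η θ) = 0}.encard = N := by
  have hlev : ∀ ℓ : ℝ, Real.cos ℓ = 0 → ∀ θ ∈ Set.Ico 0 β, η θ = ℓ →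
      (∀ᶠ t in 𝓝[>] θ, η t < ℓ) ∧ ∀ᶠ t in 𝓝[<] θ, ℓ < η t := by
    rintro ℓ hℓ θ hθ rfl
    exact hcross θ hθ hℓ
  have hinj : Set.InjOn η {θ | θ ∈ Set.Ioo 0 β ∧ Real.cos (η θ) = 0} := by
    rintro θ ⟨hθ, hc⟩ t ⟨ht, -⟩ he
    have h1 := crossing_unique hη (hlev _ hc) ⟨hθ.1.le, hθ.2⟩ ⟨ht.1.le, ht.2⟩ rfl he.symm
    have h2 := crossing_unique hη (hlev _ hc) ⟨ht.1.le, ht.2⟩ ⟨hθ.1.le, hθ.2⟩ he.symm rfl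
    exact le_antisymm (not_lt.1 h2) (not_lt.1 h1)
  have himage : η '' {θ | θ ∈ Set.Ioo 0 β ∧ Real.cos (η θ) = 0} =
      (fun k : ℕ => Real.pi / 2 + k * Real.pi) '' (Finset.range N : Set ℕ) := by
    ext y
    constructor
    · rintro ⟨θ, ⟨hθ, hc⟩, rfl⟩
      have h1 := lt_apply_zero_of_crossing hη (hlev _ hc) hθ rfl
      have h2 := le_of_crossing hη (fun θ' hθ' he => (hlev _ hc θ' hθ' he).1)
        ⟨hθ.1.le, hθ.2⟩ rfl ⟨hθ.2.le, le_rfl⟩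
      rw [hend] at h2
      obtain ⟨k, hk⟩ := Real.cos_eq_zero_iff.1 hc
      -- Once at the level, η cannot exceed it later and ends at 0, so the level is nonnegative.
      have hk0 : 0 ≤ k := by
        by_contra! hneg
        have : (k : ℝ) ≤ -1 := by exact_mod_cast Int.le_sub_one_of_lt hneg
        nlinarith [Real.pi_pos]
      lift k to ℕ using hk0
      have hk' : η θ = Real.pi / 2 + k * Real.pi := by rw [hk]; push_cast; ring
      exact ⟨k, by simpa using (hN k).2 (hk' ▸ h1), hk'.symm⟩
    · rintro ⟨k, hk, rfl⟩
      have h1 := (hN k).1 (by simpa using hk)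
      have h2 : 0 < Real.pi / 2 + k * Real.pi := by have := Real.pi_pos; positivity
      obtain ⟨θ, hθ, he⟩ := intermediate_value_Icc' hβ.le hη.continuousOn
        ⟨by rw [hend]; exact h2.le, h1.le⟩
      refine ⟨θ, ⟨⟨lt_of_le_of_ne hθ.1 ?_, lt_of_le_of_ne hθ.2 ?_⟩, ?_⟩, he⟩
      · rintro rfl
        exact h1.ne' he
      · rintro rfl
        rw [hend] at he
        exact h2.ne he
      · rw [he, cos_level]
  have hinj' : Set.InjOn (fun k : ℕ => Real.pi / 2 + k * Real.pi) (Finset.range N : Set ℕ) := by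
    intro i _ j _ hij
    simpa [Real.pi_ne_zero] using hij
  rw [← hinj.encard_image, himage, hinj'.encard_image, Set.encard_coe_eq_coe_finsetCard,
    Finset.card_range]

end Counting

/-! ### The threshold N and the eigenvalue count -/

theorem exists_isGreatest {S : ℝ} (hS : 0 ≤ S) :
    ∃ N : ℕ, IsGreatest {n : ℕ | (2 * (n : ℝ) - 1) * Real.pi < S} N ∧
      ∀ k : ℕ, k < N ↔ Real.pi / 2 + k * Real.pi < S / 2 := by
  have hpi := Real.pi_pos
  set T : Set ℕ := {n : ℕ | (2 * (n : ℝ) - 1) * Real.pi < S} with hT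
  have hne : T.Nonempty := ⟨0, by simp only [hT, Set.mem_ofPred_eq]; push_cast; nlinarith⟩
  have hbdd : BddAbove T := by
    obtain ⟨M, hM⟩ := exists_nat_gt (S / Real.pi + 1)
    refine ⟨M, fun n hn => ?_⟩
    by_contra! hlt
    have h1 : (M : ℝ) < n := by exact_mod_cast hlt
    have h2 : (2 * (n : ℝ) - 1) < S / Real.pi := (lt_div_iff₀ hpi).2 hn
    have h3 : 0 ≤ S / Real.pi := div_nonneg hS hpi.le
    linarith
  have hgr : IsGreatest T (sSup T) := ⟨Nat.sSup_mem hne hbdd, fun n hn => le_csSup hbdd hn⟩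
  refine ⟨sSup T, hgr, fun k => ?_⟩
  -- The shift by one: 2(k + 1) - 1 = 2k + 1, so membership of k + 1 says that the k-th level,
  -- counted from 0, lies below S/2.
  have hk : k + 1 ∈ T ↔ Real.pi / 2 + k * Real.pi < S / 2 := by
    simp only [hT, Set.mem_ofPred_eq]
    push_cast
    constructor <;> intro h <;> linarith
  rw [← hk]
  constructor
  · intro hlt
    have h1 : ((k + 1 : ℕ) : ℝ) ≤ (sSup T : ℕ) := by exact_mod_cast hlt
    have h2 : (2 * ((sSup T : ℕ) : ℝ) - 1) * Real.pi < S := hgr.1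
    refine lt_of_le_of_lt (mul_le_mul_of_nonneg_right ?_ hpi.le) h2
    linarith
  · intro hmem
    exact hgr.2 hmem

theorem encard_eigenvalues {u : ℝ → ℝ} {d : ℝ} (h : IsBump u d) {N : ℕ}
    (hN : ∀ k : ℕ, k < N ↔
      Real.pi / 2 + k * Real.pi < (∫ x in (-d)..d, Real.sin (u x / 2)) / 2) :
    {z : ℂ | 0 < z.re ∧ 0 < z.im ∧ IsEigenvalue u z}.encard = N := by
  obtain ⟨η, hη, hη0, hend, hev, hcross⟩ := exists_angle h
  rw [← hη0] at hN
  rw [← encard_zeros (by positivity) hη hend hcross hN]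
  have himage : {z : ℂ | 0 < z.re ∧ 0 < z.im ∧ IsEigenvalue u z} =
      (fun θ : ℝ => Complex.exp (θ * Complex.I)) ''
        {θ | θ ∈ Set.Ioo 0 (Real.pi / 2) ∧ Real.cos (η θ) = 0} := by
    ext z
    constructor
    · rintro ⟨hre, him, hz⟩
      obtain ⟨θ, hθ, rfl⟩ := exists_eq_exp (norm_eq_one_of_isEigenvalue h him hz) hre him
      exact ⟨θ, ⟨hθ, (hev θ hθ).1 hz⟩, rfl⟩
    · rintro ⟨θ, ⟨hθ, hc⟩, rfl⟩
      exact ⟨(exp_re_pos_im_pos hθ).1, (exp_re_pos_im_pos hθ).2, (hev θ hθ).2 hc⟩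
  rw [himage]
  refine Set.InjOn.encard_image ?_
  rintro θ ⟨hθ, -⟩ t ⟨ht, -⟩ he
  have hcos := congrArg Complex.re he
  simp only [Complex.exp_ofReal_mul_I_re] at hcos
  exact Real.injOn_cos ⟨hθ.1.le, by linarith [hθ.2, Real.pi_pos]⟩
    ⟨ht.1.le, by linarith [ht.2, Real.pi_pos]⟩ hcos

end SineGordon

theorem mainTheorem6 (u : ℝ → ℝ) (d : ℝ)
    (hu : ContDiff ℝ 1 u)
    (hnonneg : ∀ x : ℝ, 0 ≤ u x)
    (hsupp : ∀ x : ℝ, x ∉ Set.Icc (-d) d → u x = 0)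
    (hcrit : ∀ x : ℝ, 0 < u x → (deriv u x = 0 ↔ x = 0))
    (hpos : 0 < u 0) (hlt : u 0 < Real.pi) :
    ∃ N : ℕ,
      IsGreatest {n : ℕ | (2 * (n : ℝ) - 1) * Real.pi < ∫ x in (-d)..d, Real.sin (u x / 2)} N ∧
      {z : ℂ | 0 < z.re ∧ 0 < z.im ∧ SineGordon.IsEigenvalue u z}.encard = (N : ℕ∞) ∧
      ∀ z : ℂ, 0 < z.re → 0 < z.im → SineGordon.IsEigenvalue u z →
        ‖z‖ = 1 ∧ SineGordon.IsSimpleEigenvalue u z := by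
  have h : SineGordon.IsBump u d := ⟨hu, hnonneg, hsupp, hcrit, hpos, hlt⟩
  have hS : 0 ≤ ∫ x in (-d)..d, Real.sin (u x / 2) :=
    intervalIntegral.integral_nonneg (by linarith [h.d_pos]) fun x _ => h.sin_nonneg x
  obtain ⟨N, hgr, hN⟩ := SineGordon.exists_isGreatest hS
  exact ⟨N, hgr, SineGordon.encard_eigenvalues h hN,
    fun z hre him hev => SineGordon.isSimpleEigenvalue h hre him hev⟩
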